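/- Let $\mathcal{O}_2$ be the Cuntz algebra, i.e. the universal unital $C^*$-algebra generated by isometries $S_1,S_2$ with $S_1S_1^*+S_2S_2^*=1$, and let $\mathcal{Q}_2$ be the $2$-adic ring $C^*$-algebra, i.e. the universal unital $C^*$-algebra generated by a unitary $U$ and an isometry $S_2$ with $S_2U=U^2S_2$ and $S_2S_2^*+US_2S_2^*U^*=1$. Regard $\mathcal{O}_2$ as a subalgebra of $\mathcal{Q}_2$ through the embedding $S_1\mapsto US_2$, $S_2\mapsto S_2$, and write $\rho\upharpoonright_{\mathcal{O}_2}$ for the restriction of a representation $\rho$ of $\mathcal{Q}_2$. Representations are unital $*$-representations on complex Hilbert spaces. The canonical representation $\rho_c$ of $\mathcal{Q}_2$ acts on $\ell^2(\mathbb{Z})$ by $\rho_c(U)e_k=e_{k+1}$, $\rho_c(S_2)e_k=e_{2k}$. A representation $\rho$ of $\mathcal{Q}_2$ on $H$ is permutative if there are an orthonormal basis $(e_n)_{n\in\mathbb{N}}$ of $H$, an injection $\sigma_2$ and a bijection $\tau$ of $\mathbb{N}$ with $\rho(S_2)e_n=e_{\sigma_2(n)}$ and $\rho(U)e_n=e_{\tau(n)}$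 for all $n$. A representation $\pi$ of $\mathcal{O}_2$ is permutative if there are an orthonormal basis $(e_n)_{n\in\mathbb{N}}$ and injections $\sigma_1,\sigma_2$ of $\mathbb{N}$ whose ranges partition $\mathbb{N}$ with $\pi(S_i)e_n=e_{\sigma_i(n)}$. Its coding map then sends $n$ to the unique sequence $(i_1,i_2,\ldots)\in\{1,2\}^{\mathbb{N}}$ such that $n$ is in the range of $\sigma_{i_1}\circ\cdots\circ\sigma_{i_k}$ for every $k$. A permutative $\pi$ is multiplicity-free in the sense of Bratteli--Jorgensen if the coding map is injective (for every orthonormal basis in which $\pi$ is permutative). For a non-empty finite or an infinite multi-index $I$ in the alphabet $\{1,2\}$, a permutative representation $\pi$ of $\mathcal{O}_2$ is of type $P(I)$ if some vector $\Omega$ of a basis as above is cyclic and satisfies the following. If $I=(i_1,\ldots,i_k)$: $\pi(S_{i_1}\cdots S_{i_k})\Omega=\Omega$ and the vectors $\Omega,\ \pi(S_{i_1})\Omega,\ \ldots,\ \pi(S_{i_1}\cdots S_{i_{k-1}})\Omega$ are orthonormal. If $I=(i_1,i_2,\ldots)$ is infinite: the vectors $\Omega,\ \pi(S_{i_1}^*)\Omega,\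 \pi(S_{i_2}^*S_{i_1}^*)\Omega,\ \ldots$ are orthonormal. **Theorem.** (a) If $\rho$ is an irreducible permutative representation of $\mathcal{Q}_2$, then $\rho\upharpoonright_{\mathcal{O}_2}$ is unitarily equivalent either to $\rho_c\upharpoonright_{\mathcal{O}_2}$ or to an irreducible representation of type $P(I)$ for some $I$. Moreover $\rho\upharpoonright_{\mathcal{O}_2}$ is multiplicity-free in the sense of Bratteli--Jorgensen. (b) The irreducible permutative representations of $\mathcal{Q}_2$ are thereby classified: 1. $\rho_c$ is permutative and irreducible, and $\rho_c\upharpoonright_{\mathcal{O}_2}$ is not irreducible. 2. Every irreducible representation $\pi$ of $\mathcal{O}_2$ of type $P(I)$ with $I\neq(1)$ and $I\neq(2)$ is the restriction of exactly one representation of $\mathcal{Q}_2$ on the same space, and this extension is permutative and irreducible. 3. A representation of $\mathcal{O}_2$ of type $P(1)$ or $P(2)$ is not the restriction of any representation of $\mathcal{Q}_2$. 4. Two irreducible permutative representations of $\mathcal{Q}_2$ are unitarily equivalent if and only if their restrictions to $\mathcal{O}_2$ are. -/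

import Mathlib

open scoped ENNReal InnerProductSpace

noncomputable section

namespace TwoAdic

universe u v

/-! ### The universal unital C⋆-algebra on two contractive generators subject to a relation

For a relation `P x y` between two elements of a C⋆-algebra, the universal C⋆-algebra is realised
inside the product of all models of the relation, as the C⋆-subalgebra generated by the two
tautological elements. `UniversalCStar.existsUnique_lift` is its universal property. -/

/-- A model of the relation `P`: a nonzero unital C⋆-algebra with two contractions satisfying `P`. -/
structure Model (P : ∀ (A : Type) [CStarAlgebra A], A → A → Prop) where
  carrier : Type
  [cstar : CStarAlgebra carrier]
  [nontriv : Nontrivial carrier]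
  fst : carrier
  snd : carrier
  rel : P carrier fst snd
  norm_fst : ‖fst‖ ≤ 1
  norm_snd : ‖snd‖ ≤ 1

attribute [instance] Model.cstar Model.nontriv

/-- The C⋆-algebra of all bounded families indexed by the models of `P`. -/
def Model.Prod (P : ∀ (A : Type) [CStarAlgebra A], A → A → Prop) : Type 1 :=
  lp (fun M : Model P => M.carrier) ∞

instance Model.prodCStarAlgebra (P : ∀ (A : Type) [CStarAlgebra A], A → A → Prop) :
    CStarAlgebra (Model.Prod P) :=
  { (inferInstance : NormedRing (lp (fun M : Model P => M.carrier) ∞)),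
    (inferInstance : StarRing (lp (fun M : Model P => M.carrier) ∞)),
    (inferInstance : CompleteSpace (lp (fun M : Model P => M.carrier) ∞)),
    (inferInstance : CStarRing (lp (fun M : Model P => M.carrier) ∞)),
    (inferInstance : NormedAlgebra ℂ (lp (fun M : Model P => M.carrier) ∞)),
    (inferInstance : StarModule ℂ (lp (fun M : Model P => M.carrier) ∞)) with }

section

variable (P : ∀ (A : Type) [CStarAlgebra A], A → A → Prop)

/-- The family of the first generators. -/
def Model.prodFst : Model.Prod P :=
  ⟨fun M => M.fst, memℓp_infty ⟨1, by rintro _ ⟨M, rfl⟩; exact M.norm_fst⟩⟩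

/-- The family of the second generators. -/
def Model.prodSnd : Model.Prod P :=
  ⟨fun M => M.snd, memℓp_infty ⟨1, by rintro _ ⟨M, rfl⟩; exact M.norm_snd⟩⟩

/-- Evaluation of a bounded family at a model. -/
def Model.eval (M : Model P) : Model.Prod P →⋆ₐ[ℂ] M.carrier where
  toFun a := a.1 M
  map_one' := rfl
  map_mul' _ _ := rfl
  map_zero' := rfl
  map_add' _ _ := rfl
  commutes' _ := rfl
  map_star' _ := rfl

/-- The closed star subalgebra generated by `a` and `b`. -/
def genSub {A : Type*} [CStarAlgebra A] (a b : A) : StarSubalgebra ℂ A :=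
  (StarAlgebra.adjoin ℂ {a, b}).topologicalClosure

theorem fst_mem_genSub {A : Type*} [CStarAlgebra A] (a b : A) : a ∈ genSub a b :=
  subset_closure (StarAlgebra.subset_adjoin ℂ _ (by simp))

theorem snd_mem_genSub {A : Type*} [CStarAlgebra A] (a b : A) : b ∈ genSub a b :=
  subset_closure (StarAlgebra.subset_adjoin ℂ _ (by simp))

/-- The unital C⋆-algebra generated by `a` and `b`. -/
def Generated {A : Type v} [CStarAlgebra A] (a b : A) : Type v := genSub a b

namespace Generated

variable {A : Type v} [CStarAlgebra A] (a b : A)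

instance : CStarAlgebra (Generated a b) :=
  StarSubalgebra.cstarAlgebra (S := StarSubalgebra ℂ A) (genSub a b)
    (h_closed := StarSubalgebra.isClosed_topologicalClosure _)

def fst : Generated a b := ⟨a, fst_mem_genSub a b⟩

def snd : Generated a b := ⟨b, snd_mem_genSub a b⟩

/-- The inclusion of `C⋆(a, b)` in the ambient algebra. -/
def subtype : Generated a b →⋆ₐ[ℂ] A where
  toFun x := x.1
  map_one' := rfl
  map_mul' _ _ := rfl
  map_zero' := rfl
  map_add' _ _ := rfl
  commutes' _ := rfl
  map_star' _ := rfl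

variable {a b}

theorem hom_ext {B : Type*} [CStarAlgebra B] {φ ψ : Generated a b →⋆ₐ[ℂ] B}
    (h₁ : φ (fst a b) = ψ (fst a b)) (h₂ : φ (snd a b) = ψ (snd a b)) : φ = ψ := by
  have hc : ∀ θ : Generated a b →⋆ₐ[ℂ] B, Continuous θ := fun θ =>
    AddMonoidHomClass.continuous_of_bound θ 1 fun x => by
      simpa only [one_mul] using NonUnitalStarAlgHom.norm_apply_le θ x
  have hφ := hc φ
  have hψ := hc ψ
  refine StarAlgHom.ext fun x => ?_
  have hx : x.1 ∈ closure (StarAlgebra.adjoin ℂ {a, b} : Set A) := x.2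
  have key : ∀ y (hy : y ∈ StarAlgebra.adjoin ℂ {a, b}),
      φ ⟨y, subset_closure hy⟩ = ψ ⟨y, subset_closure hy⟩ := by
    intro y hy
    induction hy using StarAlgebra.adjoin_induction with
    | mem z hz =>
      rcases (show z = a ∨ z = b from hz) with rfl | rfl
      · exact h₁
      · exact h₂
    | algebraMap r => exact (AlgHomClass.commutes φ r).trans (AlgHomClass.commutes ψ r).symm
    | add y z hy hz h h' =>
      exact (map_add φ ⟨y, subset_closure hy⟩ ⟨z, subset_closure hz⟩).trans
        ((congrArg₂ (· + ·) h h').trans (map_add ψ ⟨y, subset_closure hy⟩ ⟨z, subset_closure hz⟩).symm)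
    | mul y z hy hz h h' =>
      exact (map_mul φ ⟨y, subset_closure hy⟩ ⟨z, subset_closure hz⟩).trans
        ((congrArg₂ (· * ·) h h').trans (map_mul ψ ⟨y, subset_closure hy⟩ ⟨z, subset_closure hz⟩).symm)
    | star y hy h =>
      exact (map_star φ ⟨y, subset_closure hy⟩).trans
        ((congrArg star h).trans (map_star ψ ⟨y, subset_closure hy⟩).symm)
  obtain ⟨f, hf, hl⟩ := mem_closure_iff_seq_limit.1 hx
  have hl' : Filter.Tendsto (fun n => (⟨f n, subset_closure (hf n)⟩ : Generated a b)) Filter.atTop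
      (nhds x) := tendsto_subtype_rng.2 hl
  refine tendsto_nhds_unique ((hφ.tendsto x).comp hl') ?_
  refine ((hψ.tendsto x).comp hl').congr fun n => ?_
  exact (key (f n) (hf n)).symm

end Generated

theorem small_generated {A : Type v} [CStarAlgebra A] (a b : A) :
    Small.{0} (Generated a b) := by
  have h1 : Small.{0} (StarAlgebra.adjoin ℂ {a, b} : StarSubalgebra ℂ A) := by
    have : ((StarAlgebra.adjoin ℂ {a, b} : StarSubalgebra ℂ A) : Set A) =
        Set.range (FreeAlgebra.lift ℂ ![a, b, star a, star b]) := by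
      rw [← StarSubalgebra.coe_toSubalgebra, StarAlgebra.adjoin_toSubalgebra,
        ← AlgHom.coe_range, ← Algebra.adjoin_range_eq_range_freeAlgebra_lift]
      congr 2
      ext x
      simp only [Set.mem_union, Set.mem_star, Set.mem_insert_iff, Set.mem_singleton_iff,
        Set.mem_range, Fin.exists_fin_succ, Fin.exists_fin_zero]
      have h : ∀ y : A, star x = y ↔ star y = x := fun y => by rw [star_eq_iff_star_eq, eq_comm]
      simp [eq_comm (a := x), h, or_assoc]
    change Small.{0} ((StarAlgebra.adjoin ℂ {a, b} : StarSubalgebra ℂ A) : Set A)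
    rw [this]
    exact small_range _
  change Small.{0} (closure ((StarAlgebra.adjoin ℂ {a, b} : StarSubalgebra ℂ A) : Set A))
  set D := ((StarAlgebra.adjoin ℂ {a, b} : StarSubalgebra ℂ A) : Set A)
  have h1' : Small.{0} D := h1
  choose f hf hl using fun x : closure D => mem_closure_iff_seq_limit.1 x.2
  refine small_of_injective (f := fun x n => (⟨f x n, hf x n⟩ : D)) fun x y hxy => ?_
  have hfxy : f x = f y := funext fun n => congrArg Subtype.val (congrFun hxy n)
  exact Subtype.ext (tendsto_nhds_unique (hl x) (hfxy ▸ hl y))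

/-- The C⋆-algebra structure of a small C⋆-algebra, carried to its copy in the lowest universe. -/
@[reducible] def shrinkCStar (A : Type v) [CStarAlgebra A] [Small.{0} A] : CStarAlgebra (Shrink.{0} A) := by
  letI : NormedRing (Shrink.{0} A) := NormedRing.induced _ A (Shrink.ringEquiv A) (Shrink.ringEquiv A).injective
  letI : NormedAlgebra ℂ (Shrink.{0} A) := NormedAlgebra.induced ℂ _ A (Shrink.algEquiv ℂ A)
  letI : StarRing (Shrink.{0} A) :=
    { star := fun x => (Shrink.ringEquiv A).symm (star (Shrink.ringEquiv A x))
      star_involutive := fun x => by simp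
      star_mul := fun x y => by simp
      star_add := fun x y => by simp }
  have hstar : ∀ x : Shrink.{0} A, Shrink.ringEquiv A (star x) = star (Shrink.ringEquiv A x) :=
    fun x => (Shrink.ringEquiv A).apply_symm_apply _
  have hnorm : ∀ x : Shrink.{0} A, ‖x‖ = ‖Shrink.ringEquiv A x‖ := fun x => rfl
  have hiso : Isometry (Shrink.ringEquiv A) := AddMonoidHomClass.isometry_of_norm _ fun x => (hnorm x).symm
  exact
  { complete := by
      have : CompleteSpace (Shrink.{0} A) :=
        (IsometryEquiv.mk (Shrink.ringEquiv A).toEquiv hiso).completeSpace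
      exact fun {f} => this.complete
    norm_mul_self_le := fun x => by
      rw [hnorm, hnorm, map_mul, hstar]
      exact CStarRing.norm_mul_self_le _
    star_smul := fun r x => by
      apply (Shrink.algEquiv ℂ A).injective
      have e : ∀ x, Shrink.algEquiv ℂ A x = Shrink.ringEquiv A x := fun x => rfl
      rw [map_smul, e, hstar, e, hstar, ← e, map_smul, star_smul]
      rfl }

/-- `C⋆(a, b)` is separable, hence has a copy in the lowest universe. -/
theorem exists_small_model {A : Type v} [CStarAlgebra A] (a b : A) :
    ∃ (B : Type) (_ : CStarAlgebra B) (φ : B →⋆ₐ[ℂ] A) (x y : B),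
      Function.Injective φ ∧ φ x = a ∧ φ y = b := by
  have := small_generated a b
  let _ := shrinkCStar (Generated a b)
  let e := Shrink.ringEquiv (Generated a b)
  let φ : Shrink.{0} (Generated a b) →⋆ₐ[ℂ] Generated a b :=
    { (Shrink.algEquiv ℂ (Generated a b) : Shrink.{0} (Generated a b) →ₐ[ℂ] Generated a b) with
      map_star' := fun x => e.apply_symm_apply _ }
  have hφ : ∀ x, φ (e.symm x) = x := fun x => e.apply_symm_apply _
  refine ⟨_, inferInstance, (Generated.subtype a b).comp φ, e.symm (Generated.fst a b),
    e.symm (Generated.snd a b), ?_, ?_, ?_⟩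
  · exact Subtype.val_injective.comp e.injective
  · exact congrArg Subtype.val (hφ _)
  · exact congrArg Subtype.val (hφ _)

/-- The universal C⋆-algebra of the relation `P`. -/
def UniversalCStar : Type 1 := Generated (Model.prodFst P) (Model.prodSnd P)

instance UniversalCStar.cstarAlgebra : CStarAlgebra (UniversalCStar P) :=
  inferInstanceAs (CStarAlgebra (Generated (Model.prodFst P) (Model.prodSnd P)))

def UniversalCStar.fst : UniversalCStar P := Generated.fst _ _

def UniversalCStar.snd : UniversalCStar P := Generated.snd _ _

/-- The representation of the universal algebra given by a model. -/
def UniversalCStar.proj (M : Model P) : UniversalCStar P →⋆ₐ[ℂ] M.carrier :=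
  (Model.eval P M).comp (Generated.subtype (Model.prodFst P) (Model.prodSnd P))

/-- The universal property, for target C⋆-algebras in an arbitrary universe. -/
theorem UniversalCStar.existsUnique_lift {B : Type v} [CStarAlgebra B] (a b : B)
    (ha : ‖a‖ ≤ 1) (hb : ‖b‖ ≤ 1)
    (hP : ∀ (A : Type) [CStarAlgebra A] (φ : A →⋆ₐ[ℂ] B) (x y : A), Function.Injective φ →
      φ x = a → φ y = b → P A x y) :
    ∃! ψ : UniversalCStar P →⋆ₐ[ℂ] B, ψ (UniversalCStar.fst P) = a ∧ ψ (UniversalCStar.snd P) = b := by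
  refine existsUnique_of_exists_of_unique ?_ fun φ ψ hφ hψ =>
    Generated.hom_ext (a := Model.prodFst P) (b := Model.prodSnd P) (hφ.1.trans hψ.1.symm)
      (hφ.2.trans hψ.2.symm)
  obtain ⟨A, _, φ, x, y, hφ, hx, hy⟩ := exists_small_model a b
  rcases subsingleton_or_nontrivial B with hB | hB
  · exact ⟨{ toFun := fun _ => 0, map_one' := Subsingleton.elim _ _, map_mul' := fun _ _ => Subsingleton.elim _ _,
             map_zero' := rfl, map_add' := fun _ _ => Subsingleton.elim _ _,
             commutes' := fun _ => Subsingleton.elim _ _, map_star' := fun _ => Subsingleton.elim _ _ },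
      Subsingleton.elim _ _, Subsingleton.elim _ _⟩
  · have : Nontrivial A := φ.toRingHom.domain_nontrivial
    have hn : ∀ z, ‖φ z‖ = ‖z‖ := NonUnitalStarAlgHom.norm_map φ hφ
    let M : Model P := ⟨A, x, y, hP A φ x y hφ hx hy, by rw [← hn, hx]; exact ha,
      by rw [← hn, hy]; exact hb⟩
    exact ⟨(φ.comp (Model.eval P M)).comp (Generated.subtype (Model.prodFst P) (Model.prodSnd P)),
      hx, hy⟩

theorem UniversalCStar.ext_proj {x y : UniversalCStar P}
    (h : ∀ M : Model P, UniversalCStar.proj P M x = UniversalCStar.proj P M y) : x = y :=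
  Subtype.ext (Subtype.ext (funext h))

end

/-! ### The Cuntz algebra `𝒪₂`, the `2`-adic ring C⋆-algebra `𝒬₂`, and the embedding -/


/-- `x₁`, `x₂` are isometries with `x₁x₁* + x₂x₂* = 1`. -/
def IsCuntzPair {A : Type*} [CStarAlgebra A] (x₁ x₂ : A) : Prop :=
  star x₁ * x₁ = 1 ∧ star x₂ * x₂ = 1 ∧ x₁ * star x₁ + x₂ * star x₂ = 1

/-- `u` is unitary, `s` is an isometry, `su = u²s` and `ss* + uss*u* = 1`. -/
def IsTwoAdicPair {A : Type*} [CStarAlgebra A] (u s : A) : Prop :=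
  star u * u = 1 ∧ u * star u = 1 ∧ star s * s = 1 ∧ s * u = u ^ 2 * s ∧
    s * star s + u * s * star s * star u = 1

theorem norm_le_one_of_isometry {A : Type*} [CStarAlgebra A] {x : A} (h : star x * x = 1) :
    ‖x‖ ≤ 1 := by
  have h1 : ‖x‖ * ‖x‖ = ‖(1 : A)‖ := by rw [← CStarRing.norm_star_mul_self, h]
  rcases subsingleton_or_nontrivial A with hA | hA
  · rw [Subsingleton.elim x 0, norm_zero]; exact zero_le_one
  · rw [CStarRing.norm_one] at h1
    nlinarith [norm_nonneg x]

/-- The defining relation of `𝒪₂`. -/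
abbrev cuntzRelation (A : Type) [CStarAlgebra A] (x₁ x₂ : A) : Prop := IsCuntzPair x₁ x₂

/-- The Cuntz algebra `𝒪₂`, universal for two isometries with `S₁S₁* + S₂S₂* = 1`. -/
abbrev O2 : Type 1 := UniversalCStar cuntzRelation

/-- The first generating isometry of `𝒪₂`. -/
def O2.S₁ : O2 := UniversalCStar.fst _

/-- The second generating isometry of `𝒪₂`. -/
def O2.S₂ : O2 := UniversalCStar.snd _

theorem O2.isCuntzPair : IsCuntzPair O2.S₁ O2.S₂ := by
  refine ⟨UniversalCStar.ext_proj cuntzRelation fun M => ?_, UniversalCStar.ext_proj cuntzRelation fun M => ?_, UniversalCStar.ext_proj cuntzRelation fun M => ?_⟩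
  · simp only [map_mul, map_star, map_one]
    exact M.rel.1
  · simp only [map_mul, map_star, map_one]
    exact M.rel.2.1
  · simp only [map_mul, map_star, map_one, map_add]
    exact M.rel.2.2

theorem O2.existsUnique_lift {B : Type v} [CStarAlgebra B] (x₁ x₂ : B) (h : IsCuntzPair x₁ x₂) :
    ∃! φ : O2 →⋆ₐ[ℂ] B, φ O2.S₁ = x₁ ∧ φ O2.S₂ = x₂ := by
  refine UniversalCStar.existsUnique_lift _ x₁ x₂ (norm_le_one_of_isometry h.1)
    (norm_le_one_of_isometry h.2.1) ?_
  rintro A _ φ x y hφ rfl rfl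
  refine ⟨hφ ?_, hφ ?_, hφ ?_⟩
  · simpa only [map_mul, map_star, map_one] using h.1
  · simpa only [map_mul, map_star, map_one] using h.2.1
  · simpa only [map_mul, map_star, map_one, map_add] using h.2.2

/-- The defining relation of `𝒬₂`. -/
abbrev twoAdicRelation (A : Type) [CStarAlgebra A] (u s : A) : Prop := IsTwoAdicPair u s

/-- The `2`-adic ring C⋆-algebra `𝒬₂`, universal for a unitary `U` and an isometry `S₂` with
`S₂U = U²S₂` and `S₂S₂* + US₂S₂*U* = 1`. -/
abbrev Q2 : Type 1 := UniversalCStar twoAdicRelation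

/-- The generating unitary of `𝒬₂`. -/
def Q2.U : Q2 := UniversalCStar.fst _

/-- The generating isometry of `𝒬₂`. -/
def Q2.S₂ : Q2 := UniversalCStar.snd _

theorem Q2.isTwoAdicPair : IsTwoAdicPair Q2.U Q2.S₂ := by
  refine ⟨UniversalCStar.ext_proj twoAdicRelation fun M => ?_, UniversalCStar.ext_proj twoAdicRelation fun M => ?_, UniversalCStar.ext_proj twoAdicRelation fun M => ?_,
    UniversalCStar.ext_proj twoAdicRelation fun M => ?_, UniversalCStar.ext_proj twoAdicRelation fun M => ?_⟩
  · simp only [map_mul, map_star, map_one]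
    exact M.rel.1
  · simp only [map_mul, map_star, map_one]
    exact M.rel.2.1
  · simp only [map_mul, map_star, map_one]
    exact M.rel.2.2.1
  · simp only [map_mul, map_pow]
    exact M.rel.2.2.2.1
  · simp only [map_mul, map_star, map_one, map_add]
    exact M.rel.2.2.2.2

theorem Q2.existsUnique_lift {B : Type v} [CStarAlgebra B] (u s : B) (h : IsTwoAdicPair u s) :
    ∃! φ : Q2 →⋆ₐ[ℂ] B, φ Q2.U = u ∧ φ Q2.S₂ = s := by
  refine UniversalCStar.existsUnique_lift _ u s (norm_le_one_of_isometry h.1)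
    (norm_le_one_of_isometry h.2.2.1) ?_
  rintro A _ φ x y hφ rfl rfl
  refine ⟨hφ ?_, hφ ?_, hφ ?_, hφ ?_, hφ ?_⟩
  · simpa only [map_mul, map_star, map_one] using h.1
  · simpa only [map_mul, map_star, map_one] using h.2.1
  · simpa only [map_mul, map_star, map_one] using h.2.2.1
  · simpa only [map_mul, map_pow] using h.2.2.2.1
  · simpa only [map_mul, map_star, map_one, map_add] using h.2.2.2.2

theorem IsTwoAdicPair.isCuntzPair {A : Type*} [CStarAlgebra A] {u s : A}
    (h : IsTwoAdicPair u s) : IsCuntzPair (u * s) s := by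
  obtain ⟨h1, _, h3, _, h5⟩ := h
  refine ⟨?_, h3, ?_⟩
  · rw [star_mul, mul_assoc, ← mul_assoc (star u), h1, one_mul, h3]
  · rw [star_mul, add_comm, ← h5]
    simp only [mul_assoc]

/-- The embedding `𝒪₂ → 𝒬₂` with `S₁ ↦ US₂` and `S₂ ↦ S₂`. -/
def embed : O2 →⋆ₐ[ℂ] Q2 :=
  (O2.existsUnique_lift (Q2.U * Q2.S₂) Q2.S₂ Q2.isTwoAdicPair.isCuntzPair).choose

theorem embed_S₁ : embed O2.S₁ = Q2.U * Q2.S₂ :=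
  (O2.existsUnique_lift (Q2.U * Q2.S₂) Q2.S₂ Q2.isTwoAdicPair.isCuntzPair).choose_spec.1.1

theorem embed_S₂ : embed O2.S₂ = Q2.S₂ :=
  (O2.existsUnique_lift (Q2.U * Q2.S₂) Q2.S₂ Q2.isTwoAdicPair.isCuntzPair).choose_spec.1.2

/-! ### The canonical representation of `𝒬₂` on `ℓ²(ℤ)` -/


/-- The Hilbert space `ℓ²(ℤ)`. -/
abbrev ell2Z : Type := lp (fun _ : ℤ => ℂ) 2

/-- The canonical orthonormal basis of `ℓ²(ℤ)`. -/
def basisZ : HilbertBasis ℤ ℂ ell2Z := ⟨LinearIsometryEquiv.refl ℂ _⟩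

theorem basisZ_ext {f g : ell2Z →L[ℂ] ell2Z} (h : ∀ k, f (basisZ k) = g (basisZ k)) : f = g :=
  ContinuousLinearMap.ext_on (Submodule.dense_iff_topologicalClosure_eq_top.2 basisZ.dense_span)
    (by rintro _ ⟨k, rfl⟩; exact h k)

/-- The isometry of `ℓ²(ℤ)` with `e k ↦ e (f k)`. -/
def shiftOp (f : ℤ → ℤ) (hf : Function.Injective f) : ell2Z →L[ℂ] ell2Z :=
  ((basisZ.orthonormal.comp f hf).orthogonalFamily.linearIsometry).toContinuousLinearMap

theorem shiftOp_apply (f : ℤ → ℤ) (hf : Function.Injective f) (k : ℤ) :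
    shiftOp f hf (basisZ k) = basisZ (f k) := by
  classical
  have h : basisZ k = lp.single 2 k (1 : ℂ) := by
    rw [← basisZ.repr_symm_single]; rfl
  have h2 := (basisZ.orthonormal.comp f hf).orthogonalFamily.linearIsometry_apply_single
    (i := k) (1 : ℂ)
  rw [h]
  refine h2.trans ?_
  simp

theorem ext_inner_basisZ {x y : ell2Z} (h : ∀ j, ⟪basisZ j, x⟫_ℂ = ⟪basisZ j, y⟫_ℂ) : x = y := by
  apply basisZ.repr.injective
  ext j
  rw [basisZ.repr_apply_apply, basisZ.repr_apply_apply, h]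

theorem inner_star_shiftOp (f : ℤ → ℤ) (hf : Function.Injective f) (j k : ℤ) :
    ⟪basisZ j, star (shiftOp f hf) (basisZ k)⟫_ℂ = if f j = k then 1 else 0 := by
  rw [ContinuousLinearMap.star_eq_adjoint, ContinuousLinearMap.adjoint_inner_right, shiftOp_apply,
    orthonormal_iff_ite.1 basisZ.orthonormal]

theorem star_shiftOp_apply (f : ℤ → ℤ) (hf : Function.Injective f) (k : ℤ) :
    star (shiftOp f hf) (basisZ (f k)) = basisZ k := by
  refine ext_inner_basisZ fun j => ?_
  rw [inner_star_shiftOp, orthonormal_iff_ite.1 basisZ.orthonormal]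
  simp [hf.eq_iff]

theorem star_shiftOp_apply_of_ne (f : ℤ → ℤ) (hf : Function.Injective f) (k : ℤ)
    (hk : ∀ j, f j ≠ k) : star (shiftOp f hf) (basisZ k) = 0 := by
  refine ext_inner_basisZ fun j => ?_
  rw [inner_star_shiftOp, inner_zero_right, if_neg (hk j)]

/-- `e k ↦ e (k + 1)`. -/
def canonicalU : ell2Z →L[ℂ] ell2Z := shiftOp (fun k => k + 1) (add_left_injective 1)

/-- `e k ↦ e (2 * k)`. -/
def canonicalS₂ : ell2Z →L[ℂ] ell2Z :=
  shiftOp (fun k => 2 * k) (mul_right_injective₀ two_ne_zero)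

theorem canonicalU_apply (k : ℤ) : canonicalU (basisZ k) = basisZ (k + 1) := shiftOp_apply _ _ k

theorem canonicalS₂_apply (k : ℤ) : canonicalS₂ (basisZ k) = basisZ (2 * k) := shiftOp_apply _ _ k

theorem star_canonicalU_apply (k : ℤ) : star canonicalU (basisZ k) = basisZ (k - 1) := by
  have h := star_shiftOp_apply (fun k => k + 1) (add_left_injective 1) (k - 1)
  simp only [sub_add_cancel] at h
  exact h

theorem star_canonicalS₂_even (k : ℤ) : star canonicalS₂ (basisZ (2 * k)) = basisZ k :=
  star_shiftOp_apply _ _ k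

theorem star_canonicalS₂_odd (k : ℤ) : star canonicalS₂ (basisZ (2 * k + 1)) = 0 :=
  star_shiftOp_apply_of_ne _ _ _ fun j => by omega

theorem canonical_isTwoAdicPair : IsTwoAdicPair canonicalU canonicalS₂ := by
  refine ⟨basisZ_ext fun k => ?_, basisZ_ext fun k => ?_, basisZ_ext fun k => ?_,
    basisZ_ext fun k => ?_, basisZ_ext fun k => ?_⟩
  · change star canonicalU (canonicalU (basisZ k)) = basisZ k
    rw [canonicalU_apply, star_canonicalU_apply, add_sub_cancel_right]
  · change canonicalU (star canonicalU (basisZ k)) = basisZ k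
    rw [star_canonicalU_apply, canonicalU_apply, sub_add_cancel]
  · change star canonicalS₂ (canonicalS₂ (basisZ k)) = basisZ k
    rw [canonicalS₂_apply, star_canonicalS₂_even]
  · rw [pow_two]
    change canonicalS₂ (canonicalU (basisZ k)) = canonicalU (canonicalU (canonicalS₂ (basisZ k)))
    simp only [canonicalU_apply, canonicalS₂_apply]
    congr 1
    ring
  · change canonicalS₂ (star canonicalS₂ (basisZ k)) +
      canonicalU (canonicalS₂ (star canonicalS₂ (star canonicalU (basisZ k)))) = basisZ k
    rw [star_canonicalU_apply]
    rcases Int.even_or_odd' k with ⟨m, rfl | rfl⟩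
    · have h : 2 * m - 1 = 2 * (m - 1) + 1 := by ring
      rw [star_canonicalS₂_even, canonicalS₂_apply, h, star_canonicalS₂_odd, map_zero, map_zero,
        add_zero]
    · rw [star_canonicalS₂_odd, add_sub_cancel_right, star_canonicalS₂_even, canonicalS₂_apply,
        canonicalU_apply, map_zero, zero_add]

/-- The canonical representation `ρ_c` of `𝒬₂`. -/
def canonicalRep : Q2 →⋆ₐ[ℂ] (ell2Z →L[ℂ] ell2Z) :=
  (Q2.existsUnique_lift canonicalU canonicalS₂ canonical_isTwoAdicPair).choose

theorem canonicalRep_U : canonicalRep Q2.U = canonicalU :=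
  (Q2.existsUnique_lift canonicalU canonicalS₂ canonical_isTwoAdicPair).choose_spec.1.1

theorem canonicalRep_S₂ : canonicalRep Q2.S₂ = canonicalS₂ :=
  (Q2.existsUnique_lift canonicalU canonicalS₂ canonical_isTwoAdicPair).choose_spec.1.2

/-! ### Words, branching function systems and the coding map -/

/-- The alphabet `{1, 2}`. -/
inductive Letter : Type
  | one
  | two

/-- `S_i`. -/
def O2.gen : Letter → O2
  | Letter.one => O2.S₁
  | Letter.two => O2.S₂

/-- `S_w = S_{i₁} ⋯ S_{i_k}` for `w = (i₁, …, i_k)`. -/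
def O2.word (w : List Letter) : O2 := (w.map O2.gen).prod

/-- `(σ₁, σ₂)` is a branching function system of order `2`: both maps are injective and their
ranges partition `ℕ`. -/
structure IsBranching (σ : Letter → ℕ → ℕ) : Prop where
  injective : ∀ i, Function.Injective (σ i)
  disjoint : Disjoint (Set.range (σ Letter.one)) (Set.range (σ Letter.two))
  union_eq : Set.range (σ Letter.one) ∪ Set.range (σ Letter.two) = Set.univ

/-- `σ_{i₁} ∘ ⋯ ∘ σ_{i_k}` for `w = (i₁, …, i_k)`. -/
def wordMap (σ : Letter → ℕ → ℕ) (w : List Letter) : ℕ → ℕ :=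
  w.foldr (fun i f => σ i ∘ f) id

/-- The word of the first `k` letters of a sequence. -/
def prefixWord (s : ℕ → Letter) (k : ℕ) : List Letter := List.ofFn fun j : Fin k => s j

/-- `n` lies in the range of `σ_{s₁} ∘ ⋯ ∘ σ_{s_k}` for every `k`. -/
def IsCode (σ : Letter → ℕ → ℕ) (n : ℕ) (s : ℕ → Letter) : Prop :=
  ∀ k, n ∈ Set.range (wordMap σ (prefixWord s k))

theorem prefixWord_succ (s : ℕ → Letter) (k : ℕ) :
    prefixWord s (k + 1) = s 0 :: prefixWord (fun j => s (j + 1)) k := by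
  simp [prefixWord, List.ofFn_succ]

theorem IsBranching.exists_eq {σ : Letter → ℕ → ℕ} (h : IsBranching σ) (n : ℕ) :
    ∃ p : Letter × ℕ, σ p.1 p.2 = n := by
  rcases (h.union_eq ▸ Set.mem_univ n : n ∈ Set.range (σ Letter.one) ∪ Set.range (σ Letter.two))
    with ⟨m, hm⟩ | ⟨m, hm⟩
  · exact ⟨(Letter.one, m), hm⟩
  · exact ⟨(Letter.two, m), hm⟩

theorem IsBranching.eq_of_eq {σ : Letter → ℕ → ℕ} (h : IsBranching σ) {i j : Letter} {m n : ℕ}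
    (hmn : σ i m = σ j n) : i = j ∧ m = n := by
  have hd := fun a b (hab : σ Letter.one a = σ Letter.two b) =>
    Set.disjoint_left.1 h.disjoint ⟨a, hab⟩ ⟨b, rfl⟩
  cases i <;> cases j
  · exact ⟨rfl, h.injective _ hmn⟩
  · exact (hd _ _ hmn).elim
  · exact (hd _ _ hmn.symm).elim
  · exact ⟨rfl, h.injective _ hmn⟩

theorem isCode_iff {σ : Letter → ℕ → ℕ} (h : IsBranching σ) {i : Letter} {m : ℕ}
    {s : ℕ → Letter} :
    IsCode σ (σ i m) s ↔ s 0 = i ∧ IsCode σ m fun j => s (j + 1) := by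
  constructor
  · intro hs
    have key : ∀ k, s 0 = i ∧ m ∈ Set.range (wordMap σ (prefixWord (fun j => s (j + 1)) k)) := by
      intro k
      obtain ⟨a, ha⟩ := hs (k + 1)
      rw [prefixWord_succ] at ha
      obtain ⟨h1, h2⟩ := h.eq_of_eq (show σ (s 0) (wordMap σ _ a) = σ i m from ha)
      exact ⟨h1, a, h2⟩
    exact ⟨(key 0).1, fun k => (key k).2⟩
  · rintro ⟨rfl, hs⟩ k
    cases k with
    | zero => exact ⟨_, rfl⟩
    | succ k =>
      obtain ⟨a, ha⟩ := hs k
      refine ⟨a, ?_⟩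
      rw [prefixWord_succ]
      exact congrArg (σ (s 0)) ha

theorem existsUnique_isCode {σ : Letter → ℕ → ℕ} (h : IsBranching σ) (n : ℕ) :
    ∃! s, IsCode σ n s := by
  choose p hp using h.exists_eq
  refine ⟨fun k => (p ((fun m => (p m).2)^[k] n)).1, ?_, ?_⟩
  · intro k
    induction k generalizing n with
    | zero => exact ⟨n, rfl⟩
    | succ k ih =>
      obtain ⟨a, ha⟩ := ih (p n).2
      refine ⟨a, ?_⟩
      rw [prefixWord_succ]
      exact (congrArg (σ (p n).1) ha).trans (hp n)
  · intro s hs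
    funext k
    induction k generalizing n s with
    | zero =>
      rw [← hp n, isCode_iff h] at hs
      exact hs.1
    | succ k ih =>
      rw [← hp n, isCode_iff h] at hs
      exact ih (p n).2 _ hs.2

/-- The coding map: `codingMap h n` is the only sequence `s` such that `n` lies in the range of
`σ_{s₁} ∘ ⋯ ∘ σ_{s_k}` for every `k`. -/
def codingMap {σ : Letter → ℕ → ℕ} (h : IsBranching σ) (n : ℕ) : ℕ → Letter :=
  (existsUnique_isCode h n).choose

theorem isCode_codingMap {σ : Letter → ℕ → ℕ} (h : IsBranching σ) (n : ℕ) :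
    IsCode σ n (codingMap h n) :=
  (existsUnique_isCode h n).choose_spec.1

/-! ### Representations -/

section

variable {A : Type*} [CStarAlgebra A]
  {H : Type u} [NormedAddCommGroup H] [InnerProductSpace ℂ H] [CompleteSpace H]
  {K : Type v} [NormedAddCommGroup K] [InnerProductSpace ℂ K] [CompleteSpace K]

/-- The representation space is nonzero and has no closed invariant subspace except `0` and
itself. -/
def IsIrreducibleRep (π : A →⋆ₐ[ℂ] (H →L[ℂ] H)) : Prop :=
  Nontrivial H ∧ ∀ M : Submodule ℂ H, IsClosed (M : Set H) → (∀ a, ∀ x ∈ M, π a x ∈ M) →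
    M = ⊥ ∨ M = ⊤

/-- Unitary equivalence of representations. -/
def UnitarilyEquivalent (π : A →⋆ₐ[ℂ] (H →L[ℂ] H)) (π' : A →⋆ₐ[ℂ] (K →L[ℂ] K)) : Prop :=
  ∃ V : H ≃ₗᵢ[ℂ] K, ∀ a x, V (π a x) = π' a (V x)

/-- `x` is a cyclic vector for `π`. -/
def IsCyclicVector (π : A →⋆ₐ[ℂ] (H →L[ℂ] H)) (x : H) : Prop :=
  Dense (Set.range fun a => π a x)

/-- The restriction to `𝒪₂` of a representation of `𝒬₂`. -/
def restrict (ρ : Q2 →⋆ₐ[ℂ] (H →L[ℂ] H)) : O2 →⋆ₐ[ℂ] (H →L[ℂ] H) := ρ.comp embed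

/-- The representation `ρ` of `𝒬₂` is permutative: on some orthonormal basis `(e n)` one has
`ρ(S₂) e n = e (σ₂ n)` and `ρ(U) e n = e (τ n)`, where `σ₂` is injective and `τ` bijective. -/
def IsPermutativeQ2 (ρ : Q2 →⋆ₐ[ℂ] (H →L[ℂ] H)) : Prop :=
  ∃ (e : HilbertBasis ℕ ℂ H) (σ₂ τ : ℕ → ℕ), Function.Injective σ₂ ∧ Function.Bijective τ ∧
    ∀ n, ρ Q2.S₂ (e n) = e (σ₂ n) ∧ ρ Q2.U (e n) = e (τ n)

/-- The representation `π` of `𝒪₂` acts on the orthonormal basis `(e n)` through the branching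
function system `(σ₁, σ₂)`, that is `π(S_i) e n = e (σ_i n)`. -/
structure IsPermutationBasis (π : O2 →⋆ₐ[ℂ] (H →L[ℂ] H)) (e : HilbertBasis ℕ ℂ H)
    (σ : Letter → ℕ → ℕ) : Prop where
  branching : IsBranching σ
  map_basis : ∀ i n, π (O2.gen i) (e n) = e (σ i n)

/-- The representation `π` of `𝒪₂` is permutative. -/
def IsPermutativeO2 (π : O2 →⋆ₐ[ℂ] (H →L[ℂ] H)) : Prop :=
  ∃ e σ, IsPermutationBasis π e σ

/-- The permutative representation `π` of `𝒪₂` is multiplicity-free in the sense of Bratteli and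
Jorgensen: its coding map is injective, whatever basis is used to exhibit `π` as permutative. -/
def IsMultiplicityFree (π : O2 →⋆ₐ[ℂ] (H →L[ℂ] H)) : Prop :=
  IsPermutativeO2 π ∧ ∀ (e : HilbertBasis ℕ ℂ H) (σ : Letter → ℕ → ℕ)
    (h : IsPermutationBasis π e σ), Function.Injective (codingMap h.branching)

/-- Finite nonempty or infinite multi-indices in the alphabet `{1, 2}`. -/
inductive MultiIndex : Type
  | finite (w : List Letter) (hw : w ≠ []) : MultiIndex
  | infinite (s : ℕ → Letter) : MultiIndex

/-- The multi-index of length one with entry `i`. -/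
def MultiIndex.single (i : Letter) : MultiIndex := MultiIndex.finite [i] (List.cons_ne_nil i [])

/-- The condition on the vector `x` in the definition of the representation of type `P(I)`.
For `I = (i₁, …, i_k)` finite: `S_I x = x`, and `x, S_{i₁} x, …, S_{i₁} ⋯ S_{i_{k-1}} x` is
orthonormal. For `I = (i₁, i₂, …)` infinite: `x, S_{i₁}* x, S_{i₂}* S_{i₁}* x, …` is orthonormal
(so that none of these vectors vanishes). -/
def IsTypePVector (π : O2 →⋆ₐ[ℂ] (H →L[ℂ] H)) (x : H) : MultiIndex → Prop
  | MultiIndex.finite w _ => π (O2.word w) x = x ∧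
      Orthonormal ℂ fun j : Fin w.length => π (O2.word (w.take j)) x
  | MultiIndex.infinite s =>
      Orthonormal ℂ fun k : ℕ => π (star (O2.word (prefixWord s k))) x

/-- `π` is a representation of type `P(I)`: it is permutative, with a cyclic basis vector
satisfying `IsTypePVector`. -/
def IsTypeP (π : O2 →⋆ₐ[ℂ] (H →L[ℂ] H)) (I : MultiIndex) : Prop :=
  ∃ (e : HilbertBasis ℕ ℂ H) (σ : Letter → ℕ → ℕ), IsPermutationBasis π e σ ∧
    ∃ n, IsCyclicVector π (e n) ∧ IsTypePVector π (e n) I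

end

end TwoAdic

end

open TwoAdic

universe u v

/-! Let T be the shift of a branching function system, the common left inverse of σ₁ and σ₂; it
deletes the first letter of a code. In 𝒬₂ one has S₁ = US₂ and US₁ = U²S₂ = S₂U, so on a permuted
basis U acts as an odometer, σ₁ᵏσ₂m ↦ σ₂ᵏσ₁m. Hence the action of 𝒪₂ forces U on every basis vector
whose code is not 1, 1, …, and everything turns on whether this code occurs.

If it does not occur, an operator intertwining the restrictions intertwines the representations of
𝒬₂ (`intertwines_of_restrict`). So the restriction stays irreducible and determines ρ. An
irreducible permutative representation of 𝒪₂ has an injective coding map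
(`IsPermutationBasis.injective_codingMap_of_irreducible`): two points with the same code lie in one
tail class of T, so their codes have an eventual period d. Then `IsBranching.exists_equiv_translate`
gives a permutation that commutes with σ₁ and σ₂ and moves each point d steps along its tail. By
Schur's lemma it is the identity, and the two points coincide. A T-periodic point now yields a
finite I, and the absence of such points an infinite I.

If the code 1, 1, … occurs, the same permutation with d = 1 also commutes with τ, so irreducibility
of ρ itself makes it trivial and every point is ultimately T-fixed. The point following the one of
code 1, 1, … is fixed by σ₂; its τ-orbit is a copy of ℤ on which σ₂ is doubling, which is the
canonical representation (`IsPermutationBasisQ2.unitarilyEquivalent_canonicalRep`).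

Conversely, an irreducible representation of type P(I) with I ≠ (1), (2) has no constant code, so
the odometer is a permutation of the whole basis and defines U. For P(1) and P(2), the operator U or
U* would carry the vector fixed by one generator to a nonzero vector fixed by the other, although
the constant code of the latter does not occur. Finally, the set of codes is a unitary invariant, so
equivalent restrictions fall in the same case. -/

namespace TwoAdic

/-! ### Reduction to the generators of a universal C⋆-algebra -/

section Universal

variable {P : ∀ (A : Type) [CStarAlgebra A], A → A → Prop}

theorem continuous_starAlgHom {A B : Type*} [CStarAlgebra A] [CStarAlgebra B]
    (θ : A →⋆ₐ[ℂ] B) : Continuous θ :=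
  AddMonoidHomClass.continuous_of_bound θ 1 fun x => by
    simpa only [one_mul] using NonUnitalStarAlgHom.norm_apply_le θ x

/-- Induction for closed properties of elements of a universal C⋆-algebra. -/
theorem UniversalCStar.induction {p : UniversalCStar P → Prop}
    (fst : p (UniversalCStar.fst P)) (snd : p (UniversalCStar.snd P))
    (algebraMap : ∀ r : ℂ, p (algebraMap ℂ _ r)) (add : ∀ x y, p x → p y → p (x + y))
    (mul : ∀ x y, p x → p y → p (x * y)) (star : ∀ x, p x → p (star x))
    (closed : IsClosed {x | p x}) (x : UniversalCStar P) : p x := by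
  have hx : x.1 ∈ closure (StarAlgebra.adjoin ℂ {Model.prodFst P, Model.prodSnd P} :
    Set (Model.Prod P)) := x.2
  have key : ∀ y (hy : y ∈ StarAlgebra.adjoin ℂ {Model.prodFst P, Model.prodSnd P}),
      p (⟨y, subset_closure hy⟩ : Generated (Model.prodFst P) (Model.prodSnd P)) := by
    intro y hy
    induction hy using StarAlgebra.adjoin_induction with
    | mem z hz =>
      rcases (show z = Model.prodFst P ∨ z = Model.prodSnd P from hz) with rfl | rfl
      · exact fst
      · exact snd
    | algebraMap r => exact algebraMap r
    | add y z hy hz h h' => exact add _ _ h h'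
    | mul y z hy hz h h' => exact mul _ _ h h'
    | star y hy h => exact star _ h
  obtain ⟨f, hf, hl⟩ := mem_closure_iff_seq_limit.1 hx
  have hl' : Filter.Tendsto
      (fun n => (⟨f n, subset_closure (hf n)⟩ : Generated (Model.prodFst P) (Model.prodSnd P)))
      Filter.atTop (nhds x) := tendsto_subtype_rng.2 hl
  exact closed.mem_of_tendsto hl' (Filter.Eventually.of_forall fun n => key _ (hf n))

variable {H : Type u} [NormedAddCommGroup H] [InnerProductSpace ℂ H] [CompleteSpace H]
  {K : Type v} [NormedAddCommGroup K] [InnerProductSpace ℂ K] [CompleteSpace K]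

/-- An operator intertwining the generators and their adjoints intertwines the representations. -/
theorem intertwines_of_generators {π : UniversalCStar P →⋆ₐ[ℂ] (H →L[ℂ] H)}
    {π' : UniversalCStar P →⋆ₐ[ℂ] (K →L[ℂ] K)} {B : H →L[ℂ] K}
    (h₁ : ∀ x, B (π (UniversalCStar.fst P) x) = π' (UniversalCStar.fst P) (B x))
    (h₂ : ∀ x, B (π (UniversalCStar.snd P) x) = π' (UniversalCStar.snd P) (B x))
    (h₁' : ∀ x, B (star (π (UniversalCStar.fst P)) x) = star (π' (UniversalCStar.fst P)) (B x))
    (h₂' : ∀ x, B (star (π (UniversalCStar.snd P)) x) = star (π' (UniversalCStar.snd P)) (B x))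
    (a : UniversalCStar P) (x : H) : B (π a x) = π' a (B x) := by
  -- The claim is carried for `a` and `star a` together, because products and adjoints mix the two.
  suffices h : (∀ x, B (π a x) = π' a (B x)) ∧ ∀ x, B (π (star a) x) = π' (star a) (B x) from h.1 x
  clear x
  induction a using UniversalCStar.induction with
  | fst => exact ⟨h₁, by simpa only [map_star] using h₁'⟩
  | snd => exact ⟨h₂, by simpa only [map_star] using h₂'⟩
  | algebraMap r =>
    have : ∀ r : ℂ, ∀ x, B (π (algebraMap ℂ _ r) x) = π' (algebraMap ℂ _ r) (B x) := fun r x => by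
      rw [AlgHomClass.commutes, AlgHomClass.commutes, Algebra.algebraMap_eq_smul_one,
        Algebra.algebraMap_eq_smul_one]
      simp
    refine ⟨this r, ?_⟩
    rw [← algebraMap_star_comm]
    exact this _
  | add a b ha hb =>
    constructor <;> intro x
    · simp [ha.1, hb.1]
    · simp [ha.2, hb.2]
  | mul a b ha hb =>
    constructor <;> intro x
    · simp [ha.1, hb.1]
    · simp only [star_mul, map_mul, mul_apply_eq_comp, ha.2, hb.2]
  | star a ha => exact ⟨ha.2, by simpa only [star_star] using ha.1⟩
  | closed =>
    have hπ := continuous_starAlgHom π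
    have hπ' := continuous_starAlgHom π'
    simp only [Set.ofPred_and, Set.ofPred_forall]
    refine (isClosed_iInter fun x => isClosed_eq ?_ ?_).inter
      (isClosed_iInter fun x => isClosed_eq ?_ ?_)
    · exact B.continuous.comp (hπ.clm_apply continuous_const)
    · exact hπ'.clm_apply continuous_const
    · exact B.continuous.comp ((hπ.comp continuous_star).clm_apply continuous_const)
    · exact (hπ'.comp continuous_star).clm_apply continuous_const

/-- A closed subspace invariant under the generators and their adjoints is invariant. -/
theorem invariant_of_generators {π : UniversalCStar P →⋆ₐ[ℂ] (H →L[ℂ] H)} {M : Submodule ℂ H}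
    (hM : IsClosed (M : Set H))
    (h₁ : ∀ x ∈ M, π (UniversalCStar.fst P) x ∈ M)
    (h₂ : ∀ x ∈ M, π (UniversalCStar.snd P) x ∈ M)
    (h₁' : ∀ x ∈ M, star (π (UniversalCStar.fst P)) x ∈ M)
    (h₂' : ∀ x ∈ M, star (π (UniversalCStar.snd P)) x ∈ M)
    (a : UniversalCStar P) : ∀ x ∈ M, π a x ∈ M := by
  suffices h : (∀ x ∈ M, π a x ∈ M) ∧ ∀ x ∈ M, π (star a) x ∈ M from h.1
  induction a using UniversalCStar.induction with
  | fst => exact ⟨h₁, by simpa only [map_star] using h₁'⟩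
  | snd => exact ⟨h₂, by simpa only [map_star] using h₂'⟩
  | algebraMap r =>
    have : ∀ r : ℂ, ∀ x ∈ M, π (algebraMap ℂ _ r) x ∈ M := fun r x hx => by
      rw [AlgHomClass.commutes, Algebra.algebraMap_eq_smul_one]
      exact M.smul_mem r hx
    refine ⟨this r, ?_⟩
    rw [← algebraMap_star_comm]
    exact this _
  | add a b ha hb =>
    simp only [star_add, map_add]
    exact ⟨fun x hx => M.add_mem (ha.1 x hx) (hb.1 x hx),
      fun x hx => M.add_mem (ha.2 x hx) (hb.2 x hx)⟩
  | mul a b ha hb =>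
    simp only [star_mul, map_mul]
    exact ⟨fun x hx => ha.1 _ (hb.1 x hx), fun x hx => hb.2 _ (ha.2 x hx)⟩
  | star a ha => exact ⟨ha.2, by simpa only [star_star] using ha.1⟩
  | closed =>
    have hπ := continuous_starAlgHom π
    simp only [Set.ofPred_and, Set.ofPred_forall]
    refine (isClosed_iInter fun x => isClosed_iInter fun _ => hM.preimage ?_).inter
      (isClosed_iInter fun x => isClosed_iInter fun _ => hM.preimage ?_)
    · exact hπ.clm_apply continuous_const
    · exact (hπ.comp continuous_star).clm_apply continuous_const

end Universal

/-! ### Schur's lemma and cyclic vectors -/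

section Irreducible

variable {A : Type*} [CStarAlgebra A]
  {H : Type u} [NormedAddCommGroup H] [InnerProductSpace ℂ H] [CompleteSpace H]
  {π : A →⋆ₐ[ℂ] (H →L[ℂ] H)}

/-- The projection on a closed invariant subspace commutes with the representation. -/
theorem starProjection_comm {M : Submodule ℂ H} [M.HasOrthogonalProjection]
    (hM : ∀ a, ∀ x ∈ M, π a x ∈ M) (a : A) (x : H) :
    M.starProjection (π a x) = π a (M.starProjection x) := by
  refine Submodule.eq_starProjection_of_mem_of_inner_eq_zero
    (hM a _ (M.starProjection_apply_mem x)) fun w hw => ?_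
  rw [← map_sub, ← ContinuousLinearMap.adjoint_inner_right, ← ContinuousLinearMap.star_eq_adjoint,
    ← map_star]
  exact M.starProjection_inner_eq_zero x _ (hM _ w hw)

/-- **Schur's lemma**: a normal operator in the commutant of an irreducible representation is
scalar. -/
theorem IsIrreducibleRep.exists_eq_smul (hπ : IsIrreducibleRep π) {B : H →L[ℂ] H}
    (hB : IsStarNormal B) (hc : ∀ a, Commute B (π a)) : ∃ c : ℂ, ∀ x, B x = c • x := by
  have : Nontrivial H := hπ.1
  have hc' : ∀ a, Commute (star B) (π a) := fun a => by
    have h := (hc (star a)).star_star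
    rwa [← map_star, star_star] at h
  obtain ⟨c, hcs⟩ : (spectrum ℂ B).Nonempty := spectrum.nonempty B
  have hsub : ∀ d ∈ spectrum ℂ B, d = c := by
    intro d hds
    by_contra hdc
    set r : ℝ := dist d c / 2 with hr
    have hr0 : 0 < r := half_pos (dist_pos.2 hdc)
    -- Tent functions of radius half the distance from `d` to `c`: each is positive at its own
    -- centre, and their product vanishes.
    let f : ℂ → ℂ → ℂ := fun w z => ((max 0 (r - dist z w) : ℝ) : ℂ)
    have hfc : ∀ w, Continuous (f w) := fun w => by fun_prop
    have hne : ∀ w ∈ spectrum ℂ B, cfc (f w) B ≠ 0 := by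
      intro w hw h0
      have h1 : cfc (f w) B = cfc (fun _ => (0 : ℂ)) B := by rw [h0, cfc_const_zero]
      have h2 := (cfc_eq_cfc_iff_eqOn (R := ℂ) (hf := (hfc w).continuousOn)
        (hg := continuousOn_const)).1 h1 hw
      simp only [f, dist_self, sub_zero, max_eq_right hr0.le, Complex.ofReal_eq_zero] at h2
      exact hr0.ne' h2
    have hmul : cfc (f c) B * cfc (f d) B = 0 := by
      rw [← cfc_mul (f c) (f d) B (hfc c).continuousOn (hfc d).continuousOn]
      have : (fun z => f c z * f d z) = fun _ => 0 := by
        funext z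
        have ht := dist_triangle_left d c z
        simp only [f, ← Complex.ofReal_mul, Complex.ofReal_eq_zero, mul_eq_zero]
        by_cases hz : r ≤ dist z c
        · left; exact max_eq_left (by linarith)
        · right; exact max_eq_left (by linarith)
      rw [this, cfc_const_zero]
    -- The kernel of f_c(B) is closed and invariant. If it is zero then f_d(B) = 0, since
    -- f_c(B)f_d(B) = 0; if it is everything then f_c(B) = 0. Both contradict `hne`.
    rcases hπ.2 (cfc (f c) B).ker (cfc (f c) B).isClosed_ker (by
      intro a x hx
      have h := DFunLike.congr_fun ((hc a).cfc (hc' a) (f c)).eq x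
      simp only [mul_apply_eq_comp] at h
      rw [LinearMap.mem_ker] at hx ⊢
      refine h.trans ?_
      erw [hx]
      exact map_zero _) with h | h
    · apply hne d hds
      ext x
      have hx : cfc (f d) B x ∈ (cfc (f c) B).ker := DFunLike.congr_fun hmul x
      rw [h] at hx
      exact hx
    · apply hne c hcs
      ext x
      have hx : x ∈ (cfc (f c) B).ker := h ▸ Submodule.mem_top
      exact hx
  refine ⟨c, fun x => ?_⟩
  have h1 : B = cfc (fun _ => c) B := by
    conv_lhs => rw [← cfc_id ℂ B]
    exact cfc_congr fun z hz => hsub z hz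
  rw [cfc_const c B] at h1
  rw [h1, Algebra.algebraMap_eq_smul_one]
  rfl

/-- Every nonzero vector is cyclic for an irreducible representation. -/
theorem IsIrreducibleRep.isCyclicVector (hπ : IsIrreducibleRep π) {x : H} (hx : x ≠ 0) :
    IsCyclicVector π x := by
  let R : Submodule ℂ H :=
    { carrier := Set.range fun a => π a x
      add_mem' := by
        rintro _ _ ⟨a, rfl⟩ ⟨b, rfl⟩
        exact ⟨a + b, by simp⟩
      zero_mem' := ⟨0, by simp⟩
      smul_mem' := by
        rintro c _ ⟨a, rfl⟩
        exact ⟨c • a, by simp⟩ }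
  have hinv : ∀ a, ∀ y ∈ R.topologicalClosure, π a y ∈ R.topologicalClosure := fun a y hy =>
    map_mem_closure (π a).continuous hy (by
      rintro _ ⟨b, rfl⟩
      exact ⟨a * b, by simp⟩)
  rcases hπ.2 R.topologicalClosure R.isClosed_topologicalClosure hinv with h | h
  · have h1 : x ∈ R.topologicalClosure := R.le_topologicalClosure ⟨1, by simp⟩
    rw [h] at h1
    exact (hx h1).elim
  · exact (Submodule.dense_iff_topologicalClosure_eq_top).2 h

end Irreducible

/-! ### The shift, codes and tails of a branching function system -/

namespace IsBranching

variable {σ : Letter → ℕ → ℕ} (h : IsBranching σ)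

/-- The first letter of the code of `n`. -/
noncomputable def letter (n : ℕ) : Letter := (h.exists_eq n).choose.1

/-- The shift: the only `m` with `n = σ_i m` for some `i`. -/
noncomputable def pred (n : ℕ) : ℕ := (h.exists_eq n).choose.2

theorem apply_letter_pred (n : ℕ) : σ (h.letter n) (h.pred n) = n := (h.exists_eq n).choose_spec

@[simp]
theorem letter_apply (i : Letter) (n : ℕ) : h.letter (σ i n) = i :=
  (h.eq_of_eq (h.apply_letter_pred (σ i n))).1

@[simp]
theorem pred_apply (i : Letter) (n : ℕ) : h.pred (σ i n) = n :=
  (h.eq_of_eq (h.apply_letter_pred (σ i n))).2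

theorem codingMap_apply_zero (n : ℕ) : codingMap h n 0 = h.letter n := by
  have h1 := isCode_codingMap h n
  conv at h1 => arg 2; rw [← h.apply_letter_pred n]
  exact ((isCode_iff h).1 h1).1

theorem codingMap_pred (n : ℕ) : codingMap h (h.pred n) = fun k => codingMap h n (k + 1) := by
  have h1 := isCode_codingMap h n
  conv at h1 => arg 2; rw [← h.apply_letter_pred n]
  exact (existsUnique_isCode h (h.pred n)).unique (isCode_codingMap h _) ((isCode_iff h).1 h1).2

theorem codingMap_iterate_pred (n j : ℕ) :
    codingMap h (h.pred^[j] n) = fun k => codingMap h n (j + k) := by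
  induction j generalizing n with
  | zero => simp
  | succ j ih =>
    rw [Function.iterate_succ_apply, ih, codingMap_pred]
    exact funext fun k => congrArg _ (by omega)

theorem codingMap_apply (n k : ℕ) : codingMap h n k = h.letter (h.pred^[k] n) := by
  rw [← codingMap_apply_zero, codingMap_iterate_pred]
  simp

theorem codingMap_congr_pred {x y : ℕ} (hxy : codingMap h x = codingMap h y) (k : ℕ) :
    codingMap h (h.pred^[k] x) = codingMap h (h.pred^[k] y) := by
  rw [codingMap_iterate_pred, codingMap_iterate_pred, hxy]

theorem codingMap_congr_apply {x y : ℕ} (hxy : codingMap h x = codingMap h y) (i : Letter) :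
    codingMap h (σ i x) = codingMap h (σ i y) := by
  funext k
  cases k with
  | zero => simp [codingMap_apply]
  | succ k =>
    have h1 := h.codingMap_pred (σ i x)
    have h2 := h.codingMap_pred (σ i y)
    rw [pred_apply] at h1 h2
    rw [← congrFun h1 k, ← congrFun h2 k, hxy]

/-- The first `k` letters of the code lead back from Tᵏx to x. A point is thus determined by its
code and any one point of its tail. -/
theorem ext_of_codingMap {x y : ℕ} (hxy : codingMap h x = codingMap h y) {k : ℕ}
    (hk : h.pred^[k] x = h.pred^[k] y) : x = y := by
  induction k generalizing x y with
  | zero => exact hk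
  | succ k ih =>
    have h1 := ih (h.codingMap_congr_pred hxy 1) (by simpa using hk)
    have h2 := congrFun hxy 0
    rw [codingMap_apply_zero, codingMap_apply_zero] at h2
    rw [← h.apply_letter_pred x, h2, show h.pred x = h.pred y from h1, h.apply_letter_pred]

/-- The point `y` is obtained by writing the first `k` letters of the code of `x` in front of `z`.
-/
theorem exists_iterate_pred_eq {x z k : ℕ} (hz : codingMap h z = codingMap h (h.pred^[k] x)) :
    ∃ y, codingMap h y = codingMap h x ∧ h.pred^[k] y = z := by
  induction k generalizing x with
  | zero => exact ⟨z, hz, rfl⟩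
  | succ k ih =>
    obtain ⟨y, hy, hyz⟩ := ih (x := h.pred x) hz
    refine ⟨σ (h.letter x) y, ?_, by simpa using hyz⟩
    rw [h.codingMap_congr_apply hy, h.apply_letter_pred]

theorem iterate_pred_congr {x y k l : ℕ} (hxy : h.pred^[k] x = h.pred^[l] y) (j : ℕ) :
    h.pred^[j + k] x = h.pred^[j + l] y := by
  rw [Function.iterate_add_apply, hxy, ← Function.iterate_add_apply]

/-- The code of `n` is periodic of period `d` from some place on. -/
def EventuallyPeriodic (d n : ℕ) : Prop :=
  ∃ k, codingMap h (h.pred^[k + d] n) = codingMap h (h.pred^[k] n)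

variable {h} in
theorem EventuallyPeriodic.exists_of_le {d n : ℕ} (hn : h.EventuallyPeriodic d n) (l : ℕ) :
    ∃ k ≥ l, codingMap h (h.pred^[k + d] n) = codingMap h (h.pred^[k] n) := by
  obtain ⟨k, hk⟩ := hn
  refine ⟨l + k, Nat.le_add_right _ _, ?_⟩
  have := h.codingMap_congr_pred hk l
  rwa [← Function.iterate_add_apply, ← Function.iterate_add_apply, ← add_assoc] at this

/-- Only the tail of a code matters for eventual periodicity, and meeting T-orbits have the same
tail up to a shift of the indices. -/
theorem eventuallyPeriodic_iff_of_iterate {d x y k l : ℕ} (hxy : h.pred^[k] x = h.pred^[l] y) :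
    h.EventuallyPeriodic d x ↔ h.EventuallyPeriodic d y := by
  have key : ∀ {x y k l : ℕ}, h.pred^[k] x = h.pred^[l] y →
      h.EventuallyPeriodic d x → h.EventuallyPeriodic d y := by
    intro x y k l hxy hx
    obtain ⟨m, hm, hmx⟩ := hx.exists_of_le k
    obtain ⟨m, rfl⟩ := Nat.exists_eq_add_of_le' hm
    refine ⟨m + l, ?_⟩
    rw [← h.iterate_pred_congr hxy, ← hmx, add_right_comm m l d, ← h.iterate_pred_congr hxy,
      add_right_comm]
  exact ⟨key hxy, key hxy.symm⟩

/-- `y` has the code of `x`, and `Tᵏy = Tᵏ⁺ᵈx` for large `k`, where `T` is the shift. -/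
def Translate (d x y : ℕ) : Prop :=
  codingMap h y = codingMap h x ∧ ∃ k, h.pred^[k] y = h.pred^[k + d] x

/-- Two translates of `x` share their code and meet under a high power of T, so they agree. Together
with `Translate.left_unique` and eventual periodicity this makes translation a bijection. -/
theorem Translate.right_unique {d x y y' : ℕ} (hy : h.Translate d x y) (hy' : h.Translate d x y') :
    y = y' := by
  obtain ⟨hc, k, hk⟩ := hy
  obtain ⟨hc', l, hl⟩ := hy'
  refine h.ext_of_codingMap (hc.trans hc'.symm) (k := k + l) ?_
  have h1 := h.iterate_pred_congr hk l
  have h2 := h.iterate_pred_congr hl k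
  rw [add_comm l k, add_left_comm] at h1
  exact h1.trans h2.symm

theorem Translate.left_unique {d x x' y : ℕ} (hy : h.Translate d x y) (hy' : h.Translate d x' y) :
    x = x' := by
  obtain ⟨hc, k, hk⟩ := hy
  obtain ⟨hc', l, hl⟩ := hy'
  refine h.ext_of_codingMap (hc.symm.trans hc') (k := k + l + d) ?_
  rw [show k + l + d = l + (k + d) by omega, ← h.iterate_pred_congr hk l,
    show l + (k + d) = k + (l + d) by omega, ← h.iterate_pred_congr hl k, add_comm]

/-- A common first letter changes neither the equality of codes nor the tails. -/
theorem Translate.apply {d x y : ℕ} (hy : h.Translate d x y) (i : Letter) :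
    h.Translate d (σ i x) (σ i y) := by
  obtain ⟨hc, k, hk⟩ := hy
  refine ⟨h.codingMap_congr_apply hc i, k + 1, ?_⟩
  rw [add_right_comm]
  simpa using hk

/-- If all codes are eventually periodic of period `d`, some permutation of `ℕ` commutes with
the branching function system and is given by `Translate d`. -/
theorem exists_equiv_translate {d : ℕ} (hd : ∀ n, h.EventuallyPeriodic d n) :
    ∃ φ : ℕ ≃ ℕ, (∀ x, h.Translate d x (φ x)) ∧ ∀ i x, φ (σ i x) = σ i (φ x) := by
  have h1 : ∀ x, ∃ y, h.Translate d x y := fun x => by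
    obtain ⟨k, hk⟩ := hd x
    obtain ⟨y, hy, hyk⟩ := h.exists_iterate_pred_eq hk
    exact ⟨y, hy, k, hyk⟩
  have h2 : ∀ y, ∃ x, h.Translate d x y := fun y => by
    obtain ⟨k, hk⟩ := hd y
    obtain ⟨x, hx, hxk⟩ := h.exists_iterate_pred_eq hk.symm
    exact ⟨x, hx.symm, k, hxk.symm⟩
  choose f hf using h1
  choose g hg using h2
  refine ⟨⟨f, g, fun x => Translate.left_unique h (hg _) (hf x),
    fun y => Translate.right_unique h (hf _) (hg y)⟩, hf, fun i x => ?_⟩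
  exact Translate.right_unique h (hf _) (Translate.apply h (hf x) i)

/-- The `k`-th power of the shift cancels `σ_w` for a word `w` of length `k`. -/
theorem iterate_pred_wordMap (w : List Letter) (n : ℕ) :
    h.pred^[w.length] (wordMap σ w n) = n := by
  induction w with
  | nil => rfl
  | cons i w ih =>
    rw [List.length_cons, Function.iterate_succ_apply]
    change h.pred^[w.length] (h.pred (σ i (wordMap σ w n))) = n
    rw [pred_apply, ih]

theorem wordMap_prefixWord_codingMap (n k : ℕ) :
    wordMap σ (prefixWord (codingMap h n) k) (h.pred^[k] n) = n := by
  obtain ⟨m, hm⟩ := isCode_codingMap h n k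
  have := h.iterate_pred_wordMap (prefixWord (codingMap h n) k) m
  rw [hm, prefixWord, List.length_ofFn] at this
  rw [this]
  exact hm

end IsBranching

/-! ### Operators and unitaries read on a Hilbert basis -/

section HilbertBasis

variable {ι κ : Type*} {H : Type u} [NormedAddCommGroup H] [InnerProductSpace ℂ H]
  {K : Type v} [NormedAddCommGroup K] [InnerProductSpace ℂ K]

theorem HilbertBasis.inner_eq_ite [DecidableEq ι] (e : HilbertBasis ι ℂ H) (i j : ι) :
    ⟪e i, e j⟫_ℂ = if i = j then 1 else 0 :=
  orthonormal_iff_ite.1 e.orthonormal i j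

theorem HilbertBasis.injective (e : HilbertBasis ι ℂ H) : Function.Injective e :=
  e.orthonormal.linearIndependent.injective

theorem HilbertBasis.ext_inner {e : HilbertBasis ι ℂ H} {x y : H}
    (h : ∀ j, ⟪e j, x⟫_ℂ = ⟪e j, y⟫_ℂ) : x = y := by
  apply e.repr.injective
  ext j
  rw [e.repr_apply_apply, e.repr_apply_apply, h]

theorem HilbertBasis.clm_ext (e : HilbertBasis ι ℂ H) {f g : H →L[ℂ] K}
    (h : ∀ i, f (e i) = g (e i)) : f = g :=
  ContinuousLinearMap.ext_on (Submodule.dense_iff_topologicalClosure_eq_top.2 e.dense_span)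
    (by rintro _ ⟨k, rfl⟩; exact h k)

theorem HilbertBasis.eq_smul_of_inner_eq_zero {e : HilbertBasis ι ℂ H} {i : ι} {x : H}
    (h : ∀ j, j ≠ i → ⟪e j, x⟫_ℂ = 0) : x = ⟪e i, x⟫_ℂ • e i := by
  classical
  refine HilbertBasis.ext_inner (e := e) fun j => ?_
  rw [inner_smul_right, HilbertBasis.inner_eq_ite]
  by_cases hj : j = i
  · simp [hj]
  · simp [hj, h j hj]

theorem LinearIsometryEquiv.intertwines_of_basis (e : HilbertBasis ι ℂ H)
    (V : H ≃ₗᵢ[ℂ] K) {A : H →L[ℂ] H} {A' : K →L[ℂ] K}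
    (h : ∀ n, V (A (e n)) = A' (V (e n))) (x : H) : V (A x) = A' (V x) :=
  DFunLike.congr_fun (HilbertBasis.clm_ext e (f := (V : H →L[ℂ] K) ∘L A)
    (g := A' ∘L (V : H →L[ℂ] K)) h) x

variable [CompleteSpace K]

/-- The Hilbert basis obtained along a bijection of the index types. -/
theorem HilbertBasis.exists_reindex (f : HilbertBasis κ ℂ K) (g : ι ≃ κ) :
    ∃ f' : HilbertBasis ι ℂ K, ∀ i, f' i = f (g i) :=
  ⟨HilbertBasis.mk (f.orthonormal.comp g g.injective) (by
    rw [g.surjective.range_comp, f.dense_span]), fun i => by simp⟩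

/-- The unitary operator which maps one Hilbert basis to another one along a bijection. -/
theorem HilbertBasis.exists_equiv (e : HilbertBasis ι ℂ H) (f : HilbertBasis κ ℂ K) (g : ι ≃ κ) :
    ∃ V : H ≃ₗᵢ[ℂ] K, ∀ i, V (e i) = f (g i) := by
  classical
  obtain ⟨f', hf'⟩ := HilbertBasis.exists_reindex f g
  refine ⟨e.repr.trans f'.repr.symm, fun i => ?_⟩
  rw [← hf', LinearIsometryEquiv.trans_apply, e.repr_self, f'.repr_symm_single]

variable [CompleteSpace H]

theorem mem_unitary_of_linearIsometryEquiv (V : H ≃ₗᵢ[ℂ] H) :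
    star (V : H →L[ℂ] H) * (V : H →L[ℂ] H) = 1 ∧ (V : H →L[ℂ] H) * star (V : H →L[ℂ] H) = 1 :=
  Unitary.mem_iff.1 (Unitary.linearIsometryEquiv.symm V).2

end HilbertBasis

/-! ### Words in the generators acting on a permuted basis -/

theorem O2.star_gen_mul_self (i : Letter) : star (O2.gen i) * O2.gen i = 1 := by
  cases i
  · exact O2.isCuntzPair.1
  · exact O2.isCuntzPair.2.1

theorem O2.star_word_mul_self (w : List Letter) : star (O2.word w) * O2.word w = 1 := by
  induction w with
  | nil => simp [O2.word]
  | cons i w ih =>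
    have : O2.word (i :: w) = O2.gen i * O2.word w := by simp [O2.word]
    rw [this, star_mul, mul_assoc, ← mul_assoc (star (O2.gen i)), O2.star_gen_mul_self, one_mul, ih]

section Branching

variable {H : Type u} [NormedAddCommGroup H] [InnerProductSpace ℂ H] [CompleteSpace H]
  {π : O2 →⋆ₐ[ℂ] (H →L[ℂ] H)} {e : HilbertBasis ℕ ℂ H} {σ : Letter → ℕ → ℕ}

theorem isometry_apply {A : H →L[ℂ] H} (hA : star A * A = 1) (x : H) : star A (A x) = x :=
  DFunLike.congr_fun hA x

namespace IsPermutationBasis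

theorem map_word (hb : IsPermutationBasis π e σ) (w : List Letter) (n : ℕ) :
    π (O2.word w) (e n) = e (wordMap σ w n) := by
  induction w with
  | nil => simp [O2.word, wordMap]
  | cons i w ih =>
    rw [O2.word, List.map_cons, List.prod_cons, map_mul, mul_apply_eq_comp]
    change π (O2.gen i) (π (O2.word w) (e n)) = e (σ i (wordMap σ w n))
    rw [ih, hb.map_basis]

theorem inner_word_eq_zero (hb : IsPermutationBasis π e σ) {w : List Letter} {j : ℕ}
    (hj : j ∉ Set.range (wordMap σ w)) (y : H) : ⟪e j, π (O2.word w) y⟫_ℂ = 0 := by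
  classical
  rw [← ContinuousLinearMap.adjoint_inner_left]
  suffices h : ContinuousLinearMap.adjoint (π (O2.word w)) (e j) = 0 by rw [h, inner_zero_left]
  refine HilbertBasis.ext_inner (e := e) fun k => ?_
  rw [ContinuousLinearMap.adjoint_inner_right, hb.map_word, HilbertBasis.inner_eq_ite,
    if_neg fun h => hj ⟨k, h⟩, inner_zero_right]

/-- A vector in the ranges of all `S_w`, for `w` an initial piece of `s`, is orthogonal to the basis
vectors with another code. -/
theorem inner_eq_zero_of_code (hb : IsPermutationBasis π e σ) {s : ℕ → Letter} {y : H}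
    (hy : ∀ k, ∃ z, π (O2.word (prefixWord s k)) z = y) {j : ℕ}
    (hj : codingMap hb.branching j ≠ s) : ⟪e j, y⟫_ℂ = 0 := by
  have : ¬ IsCode σ j s := fun h =>
    hj ((existsUnique_isCode hb.branching j).unique (isCode_codingMap _ j) h)
  simp only [IsCode, not_forall] at this
  obtain ⟨k, hk⟩ := this
  obtain ⟨z, rfl⟩ := hy k
  exact hb.inner_word_eq_zero hk z

theorem exists_word_eq (hb : IsPermutationBasis π e σ) (n k : ℕ) :
    ∃ z, π (O2.word (prefixWord (codingMap hb.branching n) k)) z = e n :=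
  ⟨e (hb.branching.pred^[k] n), by
    rw [hb.map_word, hb.branching.wordMap_prefixWord_codingMap]⟩

theorem star_gen_apply (hb : IsPermutationBasis π e σ) (i : Letter) (n : ℕ) :
    star (π (O2.gen i)) (e (σ i n)) = e n := by
  rw [← hb.map_basis]
  refine isometry_apply ?_ _
  rw [← map_star, ← map_mul, O2.star_gen_mul_self, map_one]

theorem star_gen_apply_of_ne (hb : IsPermutationBasis π e σ) {i : Letter} {n : ℕ}
    (hn : hb.branching.letter n ≠ i) : star (π (O2.gen i)) (e n) = 0 := by
  classical
  refine HilbertBasis.ext_inner (e := e) fun k => ?_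
  rw [ContinuousLinearMap.star_eq_adjoint, ContinuousLinearMap.adjoint_inner_right, hb.map_basis,
    HilbertBasis.inner_eq_ite, if_neg, inner_zero_right]
  rintro rfl
  exact hn (hb.branching.letter_apply _ _)

/-- The adjoints along the code of `n` act as powers of the shift; in this way the vectors in the
definition of P(I) for infinite I become basis vectors. -/
theorem star_word_apply (hb : IsPermutationBasis π e σ) (n k : ℕ) :
    π (star (O2.word (prefixWord (codingMap hb.branching n) k))) (e n) =
      e (hb.branching.pred^[k] n) := by
  conv_lhs => rw [← hb.branching.wordMap_prefixWord_codingMap n k, ← hb.map_word]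
  rw [hb.branching.wordMap_prefixWord_codingMap n k, map_star]
  refine isometry_apply ?_ _
  rw [← map_star, ← map_mul, O2.star_word_mul_self, map_one]

/-- If one basis has an injective coding map, every basis has. -/
theorem injective_codingMap (hb : IsPermutationBasis π e σ)
    (hinj : Function.Injective (codingMap hb.branching)) {f : HilbertBasis ℕ ℂ H}
    {σ' : Letter → ℕ → ℕ} (hb' : IsPermutationBasis π f σ') :
    Function.Injective (codingMap hb'.branching) := by
  classical
  intro n m hnm
  by_contra hne
  -- A vector f_k with the code of `n` is orthogonal to all e_j with another code. At most one e_i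
  -- has this code, so such f_k all lie on one line, or are zero; two orthonormal ones cannot.
  have key : ∀ k, codingMap hb'.branching k = codingMap hb'.branching n →
      ∀ j, codingMap hb.branching j ≠ codingMap hb'.branching n → ⟪e j, f k⟫_ℂ = 0 :=
    fun k hk j hj => hb.inner_eq_zero_of_code (fun l => hk ▸ hb'.exists_word_eq k l) hj
  by_cases hex : ∃ i, codingMap hb.branching i = codingMap hb'.branching n
  · obtain ⟨i, hi⟩ := hex
    have h1 : ∀ k, codingMap hb'.branching k = codingMap hb'.branching n →
        f k = ⟪e i, f k⟫_ℂ • e i := fun k hk =>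
      HilbertBasis.eq_smul_of_inner_eq_zero fun j hj =>
        key k hk j fun hj' => hj (hinj (hj'.trans hi.symm))
    have h0 : ⟪f n, f m⟫_ℂ = 0 := by rw [HilbertBasis.inner_eq_ite, if_neg hne]
    rw [h1 n rfl, h1 m hnm.symm, inner_smul_left, inner_smul_right, HilbertBasis.inner_eq_ite,
      if_pos rfl, mul_one, mul_eq_zero, map_eq_zero] at h0
    rcases h0 with h0 | h0
    · have := h1 n rfl
      rw [h0, zero_smul] at this
      exact f.orthonormal.ne_zero n this
    · have := h1 m hnm.symm
      rw [h0, zero_smul] at this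
      exact f.orthonormal.ne_zero m this
  · refine f.orthonormal.ne_zero n (HilbertBasis.ext_inner (e := e) fun j => ?_)
    rw [key n rfl j fun hj => hex ⟨j, hj⟩, inner_zero_right]

end IsPermutationBasis

end Branching

/-! ### From invariant index sets to invariant subspaces -/

section Support

variable {ι : Type*} {H : Type u} [NormedAddCommGroup H] [InnerProductSpace ℂ H]

/-- The closed subspace of the vectors supported in `Y`. -/
def supported (e : HilbertBasis ι ℂ H) (Y : Set ι) : Submodule ℂ H where
  carrier := {x | ∀ m ∉ Y, ⟪e m, x⟫_ℂ = 0}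
  add_mem' hx hy m hm := by rw [inner_add_right, hx m hm, hy m hm, add_zero]
  zero_mem' m _ := inner_zero_right _
  smul_mem' c x hx m hm := by rw [inner_smul_right, hx m hm, mul_zero]

theorem mem_supported {e : HilbertBasis ι ℂ H} {Y : Set ι} {x : H} :
    x ∈ supported e Y ↔ ∀ m ∉ Y, ⟪e m, x⟫_ℂ = 0 :=
  Iff.rfl

theorem isClosed_supported (e : HilbertBasis ι ℂ H) (Y : Set ι) :
    IsClosed (supported e Y : Set H) := by
  have : (supported e Y : Set H) = ⋂ m, ⋂ (_ : m ∉ Y), {x | ⟪e m, x⟫_ℂ = 0} := by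
    ext x
    simp [mem_supported]
  rw [this]
  exact isClosed_iInter fun m => isClosed_iInter fun _ =>
    isClosed_eq (continuous_const.inner continuous_id) continuous_const

theorem basis_mem_supported {e : HilbertBasis ι ℂ H} {Y : Set ι} {n : ι} :
    e n ∈ supported e Y ↔ n ∈ Y := by
  classical
  refine ⟨fun h => ?_, fun hn m hm => ?_⟩
  · by_contra hn
    exact e.orthonormal.ne_zero n (inner_self_eq_zero.1 (h n hn))
  · rw [HilbertBasis.inner_eq_ite, if_neg]
    rintro rfl
    exact hm hn

variable [CompleteSpace H]

/-- The coefficient of Ax at `m` is the inner product of A*e_m with x, so it suffices to see where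
the adjoint sends the basis vectors outside `Y`. -/
theorem map_mem_supported {e : HilbertBasis ι ℂ H} {Y : Set ι} {A : H →L[ℂ] H}
    (hA : ∀ m ∉ Y, star A (e m) = 0 ∨ ∃ j ∉ Y, star A (e m) = e j) :
    ∀ x ∈ supported e Y, A x ∈ supported e Y := fun x hx m hm => by
  rw [← ContinuousLinearMap.adjoint_inner_left, ← ContinuousLinearMap.star_eq_adjoint]
  rcases hA m hm with h | ⟨j, hj, h⟩
  · rw [h, inner_zero_left]
  · rw [h, hx j hj]

variable {π : O2 →⋆ₐ[ℂ] (H →L[ℂ] H)} {e : HilbertBasis ℕ ℂ H} {σ : Letter → ℕ → ℕ}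

theorem IsPermutationBasis.supported_invariant (hb : IsPermutationBasis π e σ) {Y : Set ℕ}
    (hY : ∀ i n, σ i n ∈ Y ↔ n ∈ Y) (a : O2) : ∀ x ∈ supported e Y, π a x ∈ supported e Y := by
  have h1 : ∀ i, ∀ x ∈ supported e Y, π (O2.gen i) x ∈ supported e Y := fun i =>
    map_mem_supported fun m hm => by
      by_cases hi : hb.branching.letter m = i
      · refine Or.inr ⟨hb.branching.pred m, fun h => hm ?_, ?_⟩
        · rw [← hb.branching.apply_letter_pred m]
          exact (hY _ _).2 h
        · conv_lhs => rw [← hb.branching.apply_letter_pred m, hi]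
          exact hb.star_gen_apply i _
      · exact Or.inl (hb.star_gen_apply_of_ne hi)
  have h2 : ∀ i, ∀ x ∈ supported e Y, star (π (O2.gen i)) x ∈ supported e Y := fun i =>
    map_mem_supported fun m hm => by
      rw [star_star]
      exact Or.inr ⟨σ i m, fun h => hm ((hY _ _).1 h), hb.map_basis i m⟩
  exact invariant_of_generators (isClosed_supported e Y) (h1 Letter.one) (h1 Letter.two)
    (h2 Letter.one) (h2 Letter.two) a

/-- An index set closed under σ₁, σ₂ and the shift spans an invariant subspace. Cyclicity thereby
becomes an induction principle over the indices. -/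
theorem IsPermutationBasis.eq_univ_of_isCyclicVector (hb : IsPermutationBasis π e σ) {n : ℕ}
    (hn : IsCyclicVector π (e n)) {Y : Set ℕ} (hY : ∀ i n, σ i n ∈ Y ↔ n ∈ Y) (hnY : n ∈ Y)
    (m : ℕ) : m ∈ Y := by
  rw [← basis_mem_supported (e := e)]
  exact (isClosed_supported e Y).closure_subset_iff.2
    (by rintro _ ⟨a, rfl⟩
        exact hb.supported_invariant hY a _ (basis_mem_supported.2 hnY)) (hn (e m))

end Support

/-! ### Irreducible permutative representations of 𝒪₂ -/

section

variable {H : Type u} [NormedAddCommGroup H] [InnerProductSpace ℂ H] [CompleteSpace H]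
  {K : Type v} [NormedAddCommGroup K] [InnerProductSpace ℂ K] [CompleteSpace K]

theorem LinearIsometryEquiv.intertwines_star (V : H ≃ₗᵢ[ℂ] K) {A : H →L[ℂ] H} {A' : K →L[ℂ] K}
    (h : ∀ x, V (A x) = A' (V x)) (x : H) : V (star A x) = star A' (V x) := by
  refine ext_inner_right ℂ fun y => ?_
  obtain ⟨z, rfl⟩ := V.surjective y
  rw [V.inner_map_map, ContinuousLinearMap.star_eq_adjoint, ContinuousLinearMap.star_eq_adjoint,
    ContinuousLinearMap.adjoint_inner_left, ContinuousLinearMap.adjoint_inner_left, ← h,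
    V.inner_map_map]

theorem LinearIsometryEquiv.intertwines_of_generators
    {P : ∀ (A : Type) [CStarAlgebra A], A → A → Prop} {π : UniversalCStar P →⋆ₐ[ℂ] (H →L[ℂ] H)}
    {π' : UniversalCStar P →⋆ₐ[ℂ] (K →L[ℂ] K)} (V : H ≃ₗᵢ[ℂ] K)
    (h₁ : ∀ x, V (π (UniversalCStar.fst P) x) = π' (UniversalCStar.fst P) (V x))
    (h₂ : ∀ x, V (π (UniversalCStar.snd P) x) = π' (UniversalCStar.snd P) (V x))
    (a : UniversalCStar P) (x : H) : V (π a x) = π' a (V x) :=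
  TwoAdic.intertwines_of_generators (B := (V : H →L[ℂ] K)) h₁ h₂
    (LinearIsometryEquiv.intertwines_star V h₁) (LinearIsometryEquiv.intertwines_star V h₂) a x

/-- A permutation of a Hilbert basis in the commutant of an irreducible representation is
trivial. -/
theorem IsIrreducibleRep.perm_eq_self {A : Type*} [CStarAlgebra A] {π : A →⋆ₐ[ℂ] (H →L[ℂ] H)}
    (hπ : IsIrreducibleRep π) {ι : Type*} {e : HilbertBasis ι ℂ H} {V : H ≃ₗᵢ[ℂ] H}
    (hV : ∀ a x, V (π a x) = π a (V x)) {φ : ι → ι} (hφ : ∀ n, V (e n) = e (φ n)) (n : ι) :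
    φ n = n := by
  classical
  have hu := mem_unitary_of_linearIsometryEquiv V
  obtain ⟨c, hc⟩ := hπ.exists_eq_smul (B := (V : H →L[ℂ] H)) ⟨hu.1.trans hu.2.symm⟩
    fun a => ContinuousLinearMap.ext fun x => hV a x
  by_contra hne
  have h1 : e (φ n) = c • e n := (hφ n).symm.trans (hc (e n))
  have h2 : ⟪e (φ n), e (φ n)⟫_ℂ = 0 := by
    conv_lhs => arg 3; rw [h1]
    rw [inner_smul_right, HilbertBasis.inner_eq_ite, if_neg hne, mul_zero]
  exact e.orthonormal.ne_zero _ (inner_self_eq_zero.1 h2)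

variable {π : O2 →⋆ₐ[ℂ] (H →L[ℂ] H)} {e : HilbertBasis ℕ ℂ H} {σ : Letter → ℕ → ℕ}

/-- The coding map of an irreducible permutative representation of `𝒪₂` is injective. -/
theorem IsPermutationBasis.injective_codingMap_of_irreducible (hb : IsPermutationBasis π e σ)
    (hπ : IsIrreducibleRep π) : Function.Injective (codingMap hb.branching) := by
  have h := hb.branching
  -- Any two T-orbits meet: the points whose orbit meets that of `y` form an invariant set.
  have trans : ∀ x y, ∃ a b, h.pred^[a] x = h.pred^[b] y := fun x y => by
    refine hb.eq_univ_of_isCyclicVector (n := y) (hπ.isCyclicVector (e.orthonormal.ne_zero y))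
      (Y := {x | ∃ a b, h.pred^[a] x = h.pred^[b] y}) (fun i n => ⟨?_, ?_⟩) ⟨0, 0, rfl⟩ x
    · rintro ⟨a, b, hab⟩
      refine ⟨a, 1 + b, ?_⟩
      rw [← h.iterate_pred_congr hab, add_comm, Function.iterate_succ_apply, h.pred_apply]
    · rintro ⟨a, b, hab⟩
      exact ⟨a + 1, b, by rwa [Function.iterate_succ_apply, h.pred_apply]⟩
  -- Equal codes and Tᵃx = Tᵃ⁺ᵈy make the code of `y`, hence every code, eventually `d`-periodic.
  -- The resulting translation is trivial by Schur's lemma, so Tᵏy = Tᵏ⁺ᵈy for some `k`, and x and y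
  -- have a common tail.
  have key : ∀ x y a d, codingMap h x = codingMap h y → h.pred^[a] x = h.pred^[a + d] y →
      x = y := by
    intro x y a d hxy had
    have hy : h.EventuallyPeriodic d y := ⟨a, by rw [← had]; exact h.codingMap_congr_pred hxy a⟩
    obtain ⟨φ, hφ, hcomm⟩ := h.exists_equiv_translate (d := d) fun n => by
      obtain ⟨k, l, hkl⟩ := trans n y
      exact (h.eventuallyPeriodic_iff_of_iterate hkl).2 hy
    obtain ⟨V, hV⟩ := HilbertBasis.exists_equiv e e φ
    have hVπ : ∀ i x, V (π (O2.gen i) x) = π (O2.gen i) (V x) := fun i =>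
      LinearIsometryEquiv.intertwines_of_basis e V fun n => by
        rw [hb.map_basis, hV, hV, hb.map_basis, hcomm]
    have hid := hπ.perm_eq_self (LinearIsometryEquiv.intertwines_of_generators V
      (hVπ Letter.one) (hVπ Letter.two)) hV
    obtain ⟨_, k, hk⟩ := hφ y
    rw [hid] at hk
    refine h.ext_of_codingMap hxy (k := k + a) ?_
    have h2 := h.iterate_pred_congr hk a
    rw [add_comm a k, add_left_comm] at h2
    exact (h.iterate_pred_congr had k).trans h2.symm
  intro x y hxy
  obtain ⟨a, b, hab⟩ := trans x y
  rcases le_total a b with hle | hle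
  · obtain ⟨d, rfl⟩ := Nat.exists_eq_add_of_le hle
    exact key x y a d hxy hab
  · obtain ⟨d, rfl⟩ := Nat.exists_eq_add_of_le hle
    exact (key y x b d hxy.symm hab.symm).symm

/-- An irreducible permutative representation of `𝒪₂` is of type `P(I)` for some `I`. -/
theorem IsPermutationBasis.exists_isTypeP (hb : IsPermutationBasis π e σ)
    (hπ : IsIrreducibleRep π) : ∃ I, IsTypeP π I := by
  classical
  have h := hb.branching
  have hcyc : ∀ n, IsCyclicVector π (e n) := fun n => hπ.isCyclicVector (e.orthonormal.ne_zero n)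
  by_cases hper : ∃ x, ∃ p, 0 < p ∧ h.pred^[p] x = x
  · obtain ⟨x, hx⟩ := hper
    -- Minimality of the period is what makes the vectors in the definition of P(I) distinct.
    set p := Nat.find hx with hp
    obtain ⟨hp0, hpx⟩ := Nat.find_spec hx
    set w := prefixWord (codingMap h x) p with hw
    have hlen : w.length = p := by simp [w, prefixWord]
    refine ⟨MultiIndex.finite w fun h0 => ?_, e, σ, hb, x, hcyc x, ?_, ?_⟩
    · rw [h0, List.length_nil] at hlen
      omega
    · rw [hb.map_word]
      conv_lhs => arg 2; arg 3; rw [← hpx]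
      rw [h.wordMap_prefixWord_codingMap]
    · have heq : (fun j : Fin w.length => π (O2.word (w.take j)) (e x)) =
          e ∘ fun j : Fin w.length => wordMap σ (w.take j) x :=
        funext fun j => hb.map_word _ _
      rw [heq]
      refine e.orthonormal.comp _ ?_
      -- If the images of `x` under the words of lengths i < j agreed, applying Tʲ would give Tʲ⁻ⁱx
      -- = x with j - i below the minimal period.
      have key : ∀ i j : ℕ, i < j → j < w.length →
          wordMap σ (w.take i) x ≠ wordMap σ (w.take j) x := by
        intro i j hij hj hne
        have h1 := h.iterate_pred_wordMap (w.take i) x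
        have h2 := h.iterate_pred_wordMap (w.take j) x
        rw [List.length_take, min_eq_left (by omega)] at h1 h2
        obtain ⟨d, rfl⟩ := Nat.exists_eq_add_of_lt hij
        rw [← hne, add_right_comm, add_assoc, add_comm i, Function.iterate_add_apply,
          h1] at h2
        exact Nat.find_min hx (m := 1 + d) (by omega) ⟨by omega, h2⟩
      intro i j hij
      rcases lt_trichotomy i.1 j.1 with hlt | heq | hlt
      · exact (key _ _ hlt j.2 hij).elim
      · exact Fin.ext heq
      · exact (key _ _ hlt i.2 hij.symm).elim
  -- Without periodic points every T-orbit is injective, so any basis vector serves as Ω; index 0 is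
  -- an arbitrary choice.
  · refine ⟨MultiIndex.infinite (codingMap h 0), e, σ, hb, 0, hcyc 0, ?_⟩
    have heq : (fun k => π (star (O2.word (prefixWord (codingMap h 0) k))) (e 0)) =
        e ∘ fun k => h.pred^[k] 0 :=
      funext fun k => hb.star_word_apply 0 k
    change Orthonormal ℂ _
    rw [heq]
    refine e.orthonormal.comp _ ?_
    have key : ∀ i j : ℕ, i < j → h.pred^[i] 0 ≠ h.pred^[j] 0 := by
      intro i j hij hne
      obtain ⟨d, rfl⟩ := Nat.exists_eq_add_of_lt hij
      rw [add_assoc, add_comm i, Function.iterate_add_apply] at hne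
      exact hper ⟨_, _, Nat.succ_pos d, hne.symm⟩
    intro i j hij
    rcases lt_trichotomy i j with hlt | heq | hlt
    · exact (key _ _ hlt hij).elim
    · exact heq
    · exact (key _ _ hlt hij.symm).elim

/-- If an irreducible representation of type `P(I)` has a basis vector of code `i, i, …`, then
`I = (i)`. -/
theorem IsTypeP.eq_single {I : MultiIndex} (hπ : IsIrreducibleRep π)
    (hb : IsPermutationBasis π e σ) {n : ℕ} (hn : IsTypePVector π (e n) I) {i : Letter} {m : ℕ}
    (hm : codingMap hb.branching m = fun _ => i) : I = MultiIndex.single i := by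
  have h := hb.branching
  -- Deleting a letter of a constant code does not change it, so injectivity of the coding map gives
  -- a fixed point.
  have hfix : h.pred m = m := by
    apply hb.injective_codingMap_of_irreducible hπ
    rw [h.codingMap_pred, hm]
  have hfix' : σ i m = m := by
    conv_rhs => rw [← h.apply_letter_pred m, hfix, ← h.codingMap_apply_zero, hm]
  obtain ⟨k, hk⟩ : ∃ k, h.pred^[k] n = m := by
    refine hb.eq_univ_of_isCyclicVector (n := m) (hπ.isCyclicVector (e.orthonormal.ne_zero m))
      (Y := {x | ∃ k, h.pred^[k] x = m}) (fun i n => ⟨?_, ?_⟩) ⟨0, rfl⟩ n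
    · rintro ⟨k, hk⟩
      refine ⟨k, ?_⟩
      have h1 := congrArg h.pred hk
      rwa [← Function.iterate_succ_apply' h.pred, Function.iterate_succ_apply, h.pred_apply,
        hfix] at h1
    · rintro ⟨k, hk⟩
      exact ⟨k + 1, by rwa [Function.iterate_succ_apply, h.pred_apply]⟩
  cases I with
  | finite w hw =>
    obtain ⟨h1, h2⟩ := hn
    rw [hb.map_word] at h1
    replace h1 : wordMap σ w n = n := HilbertBasis.injective e h1
    have h3 : h.pred^[w.length] n = n := by
      conv_lhs => arg 3; rw [← h1]
      exact h.iterate_pred_wordMap w n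
    -- The orbit of `n` returns to `n` at every multiple of the length of `w`, yet stays at `m` from
    -- time `k` on.
    have h4 : n = m := by
      have hper : h.pred^[w.length * k] n = n := by
        rw [Function.iterate_mul]
        exact Function.iterate_fixed h3 k
      obtain ⟨j, hj⟩ : ∃ j, w.length = j + 1 := Nat.exists_eq_add_of_le' (List.length_pos_iff.2 hw)
      rw [hj, add_mul, one_mul, Function.iterate_add_apply, hk, Function.iterate_fixed hfix] at hper
      exact hper.symm
    subst h4
    rcases w with _ | ⟨a, _ | ⟨b, w⟩⟩
    · exact (hw rfl).elim
    · obtain rfl : a = i := (h.eq_of_eq (h1.trans hfix'.symm)).1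
      rfl
    · obtain rfl : a = i := (h.eq_of_eq (h1.trans hfix'.symm)).1
      -- For a word of length at least two, Ω and S_iΩ would be orthogonal, but they are equal.
      have h5 : (⟨0, by simp⟩ : Fin (a :: b :: w).length) = ⟨1, by simp⟩ := by
        apply h2.linearIndependent.injective
        simp only [hb.map_word]
        exact congrArg e hfix'.symm
      simp at h5
  | infinite s =>
    have hn' : Orthonormal ℂ fun k : ℕ => π (star (O2.word (prefixWord s k))) (e n) := hn
    -- If `n` left the range of a prefix of `s`, the adjoint of that word would kill e_n, against
    -- orthonormality. So `s` is the code of `n`.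
    have hs : IsCode σ n s := fun k => by
      by_contra hk
      refine hn'.ne_zero k ?_
      refine ext_inner_right ℂ fun y => ?_
      rw [map_star, ContinuousLinearMap.star_eq_adjoint, ContinuousLinearMap.adjoint_inner_left,
        hb.inner_word_eq_zero hk, inner_zero_left]
    obtain rfl : s = codingMap h n := (existsUnique_isCode h n).unique hs (isCode_codingMap h n)
    have h5 : k = k + 1 := by
      apply hn'.linearIndependent.injective
      simp only [hb.star_word_apply, Function.iterate_succ_apply', hk, hfix]
    omega

end

/-! ### Restriction from 𝒬₂ to 𝒪₂ -/

section

variable {H : Type u} [NormedAddCommGroup H] [InnerProductSpace ℂ H] [CompleteSpace H]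
  {K : Type v} [NormedAddCommGroup K] [InnerProductSpace ℂ K] [CompleteSpace K]
  {ρ : Q2 →⋆ₐ[ℂ] (H →L[ℂ] H)} {ρ' : Q2 →⋆ₐ[ℂ] (K →L[ℂ] K)}

theorem restrict_two (ρ : Q2 →⋆ₐ[ℂ] (H →L[ℂ] H)) :
    restrict ρ (O2.gen Letter.two) = ρ Q2.S₂ :=
  congrArg ρ embed_S₂

theorem restrict_one_apply (ρ : Q2 →⋆ₐ[ℂ] (H →L[ℂ] H)) (x : H) :
    restrict ρ (O2.gen Letter.one) x = ρ Q2.U (restrict ρ (O2.gen Letter.two) x) := by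
  have h : restrict ρ (O2.gen Letter.one) = ρ (Q2.U * Q2.S₂) := congrArg ρ embed_S₁
  rw [h, map_mul, restrict_two]
  rfl

/-- This is S₂U = U²S₂ with US₂ read as S₁. It is the carry rule of the odometer. -/
theorem U_restrict_one_apply (ρ : Q2 →⋆ₐ[ℂ] (H →L[ℂ] H)) (x : H) :
    ρ Q2.U (restrict ρ (O2.gen Letter.one) x) = restrict ρ (O2.gen Letter.two) (ρ Q2.U x) := by
  have h := DFunLike.congr_fun (congrArg ρ Q2.isTwoAdicPair.2.2.2.1) x
  rw [restrict_one_apply, restrict_two]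
  simp only [map_mul, pow_two] at h
  exact h.symm

theorem star_U_U_apply (ρ : Q2 →⋆ₐ[ℂ] (H →L[ℂ] H)) (x : H) :
    star (ρ Q2.U) (ρ Q2.U x) = x := by
  refine isometry_apply ?_ x
  rw [← map_star, ← map_mul, Q2.isTwoAdicPair.1, map_one]

theorem U_star_U_apply (ρ : Q2 →⋆ₐ[ℂ] (H →L[ℂ] H)) (x : H) :
    ρ Q2.U (star (ρ Q2.U) x) = x := by
  have h := DFunLike.congr_fun (congrArg ρ Q2.isTwoAdicPair.2.1) x
  simp only [map_mul, map_star, map_one] at h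
  exact h

/-- If no basis vector has the code `1, 1, …`, an operator which intertwines the restrictions
to `𝒪₂` of two representations of `𝒬₂` intertwines the representations. -/
theorem intertwines_of_restrict {e : HilbertBasis ℕ ℂ H} {σ : Letter → ℕ → ℕ}
    (hb : IsPermutationBasis (restrict ρ) e σ)
    (hcode : ∀ n, codingMap hb.branching n ≠ fun _ => Letter.one) {B : H →L[ℂ] K}
    (hB : ∀ a x, B (restrict ρ a x) = restrict ρ' a (B x)) (a : Q2) (x : H) :
    B (ρ a x) = ρ' a (B x) := by
  have h := hb.branching
  -- Induction on the position of a letter 2: each leading 1 is removed by US₁ = S₂U, and at a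
  -- leading 2 one has US₂ = S₁.
  have key : ∀ k n, h.letter (h.pred^[k] n) = Letter.two →
      B (ρ Q2.U (e n)) = ρ' Q2.U (B (e n)) := by
    intro k
    induction k with
    | zero =>
      intro n hn
      rw [Function.iterate_zero_apply] at hn
      rw [← h.apply_letter_pred n, hn, ← hb.map_basis, ← restrict_one_apply, hB, hB,
        restrict_one_apply]
    | succ k ih =>
      intro n hn
      rw [← h.apply_letter_pred n]
      cases h.letter n with
      | one =>
        rw [← hb.map_basis, U_restrict_one_apply, hB, hB, ih _ hn, U_restrict_one_apply]
      | two => rw [← hb.map_basis, ← restrict_one_apply, hB, hB, restrict_one_apply]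
  have hU : ∀ x, B (ρ Q2.U x) = ρ' Q2.U (B x) := by
    refine DFunLike.congr_fun (HilbertBasis.clm_ext e (f := B ∘L ρ Q2.U) (g := ρ' Q2.U ∘L B)
      fun n => ?_)
    obtain ⟨k, hk⟩ := Function.ne_iff.1 (hcode n)
    rw [h.codingMap_apply] at hk
    refine key k n ?_
    cases hl : h.letter (h.pred^[k] n) with
    | one => exact (hk hl).elim
    | two => rfl
  refine intertwines_of_generators hU ?_ ?_ ?_ a x
  · exact fun x => by
      have := hB (O2.gen Letter.two) x
      rwa [restrict_two, restrict_two] at this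
  · intro x
    change B (star (ρ Q2.U) x) = star (ρ' Q2.U) (B x)
    conv_rhs => rw [← U_star_U_apply ρ x, hU, star_U_U_apply]
  · exact fun x => by
      have := hB (star (O2.gen Letter.two)) x
      rwa [map_star, map_star, restrict_two, restrict_two] at this

theorem isIrreducibleRep_of_restrict (h : IsIrreducibleRep (restrict ρ)) : IsIrreducibleRep ρ :=
  ⟨h.1, fun M hM hinv => h.2 M hM fun a => hinv (embed a)⟩

/-- The projection on a subspace invariant under 𝒪₂ commutes with the restriction, hence with ρ, so
the subspace is invariant under 𝒬₂. -/
theorem isIrreducibleRep_restrict (hρ : IsIrreducibleRep ρ) {e : HilbertBasis ℕ ℂ H}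
    {σ : Letter → ℕ → ℕ} (hb : IsPermutationBasis (restrict ρ) e σ)
    (hcode : ∀ n, codingMap hb.branching n ≠ fun _ => Letter.one) :
    IsIrreducibleRep (restrict ρ) := by
  refine ⟨hρ.1, fun M hM hinv => hρ.2 M hM fun a x hx => ?_⟩
  have : CompleteSpace M := hM.completeSpace_coe
  have h := intertwines_of_restrict (ρ' := ρ) hb hcode (B := M.starProjection)
    (starProjection_comm hinv) a x
  rw [Submodule.starProjection_eq_self_iff.2 hx] at h
  exact Submodule.starProjection_eq_self_iff.1 h

/-- Apply S₁S₁* + S₂S₂* = 1 to e_n: an index in both ranges would give 2e_n = e_n, an index in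
neither 0 = e_n. -/
theorem isBranching_of_map_basis {π : O2 →⋆ₐ[ℂ] (H →L[ℂ] H)} {e : HilbertBasis ℕ ℂ H}
    {σ : Letter → ℕ → ℕ} (hinj : ∀ i, Function.Injective (σ i))
    (h : ∀ i n, π (O2.gen i) (e n) = e (σ i n)) : IsBranching σ := by
  classical
  have hsum : ∀ x, π (O2.gen Letter.one) (star (π (O2.gen Letter.one)) x) +
      π (O2.gen Letter.two) (star (π (O2.gen Letter.two)) x) = x := fun x => by
    have := DFunLike.congr_fun (congrArg π O2.isCuntzPair.2.2) x
    simp only [map_add, map_mul, map_star, map_one] at this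
    exact this
  have hstar : ∀ i n, star (π (O2.gen i)) (e (σ i n)) = e n := fun i n => by
    rw [← h]
    refine isometry_apply ?_ _
    rw [← map_star, ← map_mul, O2.star_gen_mul_self, map_one]
  have hstar' : ∀ i n, n ∉ Set.range (σ i) → star (π (O2.gen i)) (e n) = 0 := fun i n hn => by
    refine HilbertBasis.ext_inner (e := e) fun k => ?_
    rw [ContinuousLinearMap.star_eq_adjoint, ContinuousLinearMap.adjoint_inner_right, h,
      HilbertBasis.inner_eq_ite, if_neg fun hk => hn ⟨k, hk⟩, inner_zero_right]
  refine ⟨hinj, Set.disjoint_left.2 ?_, Set.eq_univ_of_forall fun n => ?_⟩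
  · rintro n ⟨a, rfl⟩ ⟨b, hb⟩
    have h1 := hsum (e (σ Letter.one a))
    rw [hstar, h] at h1
    rw [← hb, hstar, h, hb] at h1
    exact e.orthonormal.ne_zero _ (add_eq_left.1 h1)
  · by_contra hn
    rw [Set.mem_union, not_or] at hn
    have h1 := hsum (e n)
    rw [hstar' _ _ hn.1, hstar' _ _ hn.2, map_zero, map_zero, add_zero] at h1
    exact e.orthonormal.ne_zero n h1.symm

/-- The branching function system of a permutative representation of `𝒬₂`. -/
def branchingOf (σ₂ τ : ℕ → ℕ) : Letter → ℕ → ℕ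
  | Letter.one => τ ∘ σ₂
  | Letter.two => σ₂

/-- The representation `ρ` of `𝒬₂` permutes the basis `(e n)` by `σ₂` and `τ`. -/
structure IsPermutationBasisQ2 (ρ : Q2 →⋆ₐ[ℂ] (H →L[ℂ] H)) (e : HilbertBasis ℕ ℂ H)
    (σ₂ : ℕ → ℕ) (τ : Equiv.Perm ℕ) : Prop where
  injective : Function.Injective σ₂
  map_S₂ : ∀ n, ρ Q2.S₂ (e n) = e (σ₂ n)
  map_U : ∀ n, ρ Q2.U (e n) = e (τ n)

theorem IsPermutativeQ2.exists_basis (h : IsPermutativeQ2 ρ) :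
    ∃ e σ₂ τ, IsPermutationBasisQ2 ρ e σ₂ τ := by
  obtain ⟨e, σ₂, τ, h1, h2, h3⟩ := h
  exact ⟨e, σ₂, Equiv.ofBijective τ h2, h1, fun n => (h3 n).1, fun n => (h3 n).2⟩

/-! ### The odometer on a permuted basis of 𝒬₂ -/

namespace IsPermutationBasisQ2

variable {e : HilbertBasis ℕ ℂ H} {σ₂ : ℕ → ℕ} {τ : Equiv.Perm ℕ}

theorem isPermutationBasis (hb : IsPermutationBasisQ2 ρ e σ₂ τ) :
    IsPermutationBasis (restrict ρ) e (branchingOf σ₂ τ) := by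
  have h : ∀ i n, restrict ρ (O2.gen i) (e n) = e (branchingOf σ₂ τ i n) := by
    intro i n
    cases i with
    | one =>
      rw [restrict_one_apply, restrict_two, hb.map_S₂, hb.map_U]
      rfl
    | two =>
      rw [restrict_two, hb.map_S₂]
      rfl
  refine ⟨isBranching_of_map_basis (fun i => ?_) h, h⟩
  cases i with
  | one => exact τ.injective.comp hb.injective
  | two => exact hb.injective

theorem tau_one (hb : IsPermutationBasisQ2 ρ e σ₂ τ) (n : ℕ) :
    τ (branchingOf σ₂ τ Letter.one n) = branchingOf σ₂ τ Letter.two (τ n) := by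
  have h := U_restrict_one_apply ρ (e n)
  rw [hb.isPermutationBasis.map_basis, hb.map_U, hb.map_U, hb.isPermutationBasis.map_basis] at h
  exact HilbertBasis.injective e h

/-- The induction principle over indices for 𝒬₂. Here `Y` must also be stable under τ and its
inverse, since the restriction to 𝒪₂ may be reducible. -/
theorem eq_univ_of_isIrreducibleRep (hb : IsPermutationBasisQ2 ρ e σ₂ τ) (hρ : IsIrreducibleRep ρ)
    {Y : Set ℕ} (hσ : ∀ n, σ₂ n ∈ Y ↔ n ∈ Y) (hτ : ∀ n, τ n ∈ Y ↔ n ∈ Y) {n : ℕ} (hn : n ∈ Y)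
    (m : ℕ) : m ∈ Y := by
  have hY : ∀ i n, branchingOf σ₂ τ i n ∈ Y ↔ n ∈ Y := by
    intro i n
    cases i with
    | one => exact (hτ _).trans (hσ n)
    | two => exact hσ n
  have hS := hb.isPermutationBasis.supported_invariant hY
  have hinv := invariant_of_generators (π := ρ) (isClosed_supported e Y) (map_mem_supported
      fun m hm => Or.inr ⟨τ.symm m, fun h => hm (by simpa using (hτ (τ.symm m)).2 h), by
        conv_lhs => rw [← τ.apply_symm_apply m, ← hb.map_U]
        exact star_U_U_apply ρ _⟩)
    (fun x hx => by
      have := hS (O2.gen Letter.two) x hx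
      rwa [restrict_two] at this)
    (map_mem_supported fun m hm => Or.inr ⟨τ m, fun h => hm ((hτ m).1 h), by
      rw [star_star]
      exact hb.map_U m⟩)
    (fun x hx => by
      have := hS (star (O2.gen Letter.two)) x hx
      rwa [map_star, restrict_two] at this)
  rw [← basis_mem_supported (e := e)]
  rcases hρ.2 _ (isClosed_supported e Y) hinv with h | h
  · have h1 : e n ∈ supported e Y := basis_mem_supported.2 hn
    rw [h] at h1
    exact (e.orthonormal.ne_zero n h1).elim
  · rw [h]
    exact Submodule.mem_top

/-- The carry: a leading 1 turns into 2, and the odometer passes to the rest of the code. -/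
theorem letter_tau_of_one (hb : IsPermutationBasisQ2 ρ e σ₂ τ) {n : ℕ}
    (hn : hb.isPermutationBasis.branching.letter n = Letter.one) :
    hb.isPermutationBasis.branching.letter (τ n) = Letter.two ∧
      hb.isPermutationBasis.branching.pred (τ n) =
        τ (hb.isPermutationBasis.branching.pred n) := by
  have h := hb.isPermutationBasis.branching
  have h1 := hb.tau_one (h.pred n)
  rw [← hn, h.apply_letter_pred] at h1
  rw [h1]
  exact ⟨h.letter_apply _ _, h.pred_apply _ _⟩

/-- On the code 1, 1, … the carry never stops, so every letter is changed. -/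
theorem codingMap_tau (hb : IsPermutationBasisQ2 ρ e σ₂ τ) {n : ℕ}
    (hn : codingMap hb.isPermutationBasis.branching n = fun _ => Letter.one) :
    codingMap hb.isPermutationBasis.branching (τ n) = fun _ => Letter.two := by
  have h := hb.isPermutationBasis.branching
  have key : ∀ k, h.pred^[k] (τ n) = τ (h.pred^[k] n) := by
    intro k
    induction k with
    | zero => rfl
    | succ k ih =>
      rw [Function.iterate_succ_apply', Function.iterate_succ_apply', ih]
      exact (hb.letter_tau_of_one (by rw [← h.codingMap_apply, hn])).2
  funext k
  rw [h.codingMap_apply, key]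
  exact (hb.letter_tau_of_one (by rw [← h.codingMap_apply, hn])).1

/-- If the code of `n` is not `1, 1, …`, then `n` and `τ n` have a common image under a power of
the shift. -/
theorem exists_iterate_pred_tau (hb : IsPermutationBasisQ2 ρ e σ₂ τ) {n : ℕ}
    (hn : codingMap hb.isPermutationBasis.branching n ≠ fun _ => Letter.one) :
    ∃ k, hb.isPermutationBasis.branching.pred^[k] (τ n) =
      hb.isPermutationBasis.branching.pred^[k] n := by
  have h := hb.isPermutationBasis.branching
  have two : ∀ n, h.letter n = Letter.two → h.pred (τ n) = h.pred n := fun n hn => by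
    conv_lhs => rw [← h.apply_letter_pred n, hn]
    exact h.pred_apply Letter.one (h.pred n)
  have key : ∀ k n, h.letter (h.pred^[k] n) = Letter.two →
      h.pred^[k + 1] (τ n) = h.pred^[k + 1] n := by
    intro k
    induction k with
    | zero => exact fun n hn => two n hn
    | succ k ih =>
      intro n hn
      rw [Function.iterate_succ_apply h.pred, Function.iterate_succ_apply h.pred (k + 1) n]
      cases hl : h.letter n with
      | one =>
        rw [(hb.letter_tau_of_one hl).2]
        exact ih _ hn
      | two => rw [two n hl]
  obtain ⟨k, hk⟩ := Function.ne_iff.1 hn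
  rw [h.codingMap_apply] at hk
  refine ⟨k + 1, key k n ?_⟩
  cases hl : h.letter (h.pred^[k] n) with
  | one => exact (hk hl).elim
  | two => rfl

end IsPermutationBasisQ2

end

/-! ### Representations of 𝒬₂ in which the code 1, 1, … occurs -/

section

variable {H : Type u} [NormedAddCommGroup H] [InnerProductSpace ℂ H] [CompleteSpace H]
  {K : Type v} [NormedAddCommGroup K] [InnerProductSpace ℂ K] [CompleteSpace K]
  {ρ : Q2 →⋆ₐ[ℂ] (H →L[ℂ] H)} {ρ' : Q2 →⋆ₐ[ℂ] (K →L[ℂ] K)}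

namespace IsPermutationBasisQ2

variable {e : HilbertBasis ℕ ℂ H} {σ₂ : ℕ → ℕ} {τ : Equiv.Perm ℕ}

/-- If some code is `1, 1, …`, every point is ultimately fixed by the shift. -/
theorem exists_iterate_pred_fixed (hb : IsPermutationBasisQ2 ρ e σ₂ τ) (hρ : IsIrreducibleRep ρ)
    {n : ℕ} (hn : codingMap hb.isPermutationBasis.branching n = fun _ => Letter.one) :
    (∀ x, ∃ k, hb.isPermutationBasis.branching.pred^[k] x =
      hb.isPermutationBasis.branching.pred^[k + 1] x) ∧
    hb.isPermutationBasis.branching.pred (τ n) = τ n := by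
  have h := hb.isPermutationBasis.branching
  have const : ∀ {x : ℕ} {i : Letter}, codingMap h x = (fun _ => i) →
      codingMap h (h.pred x) = codingMap h x := fun hx => by rw [h.codingMap_pred, hx]
  -- Codes constant from some place on form a set stable under σ₂ and τ: off the code 1, 1, … the
  -- map τ preserves tails, and on it τ passes to the constant code 2, 2, ….
  have hEP : ∀ x, h.EventuallyPeriodic 1 x := by
    refine hb.eq_univ_of_isIrreducibleRep hρ (Y := {x | h.EventuallyPeriodic 1 x}) (fun x => ?_)
      (fun x => ?_) ⟨0, const hn⟩
    · exact h.eventuallyPeriodic_iff_of_iterate (k := 1) (l := 0) (h.pred_apply Letter.two x)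
    · by_cases hx : codingMap h x = fun _ => Letter.one
      · exact iff_of_true ⟨0, const (hb.codingMap_tau hx)⟩ ⟨0, const hx⟩
      · obtain ⟨k, hk⟩ := hb.exists_iterate_pred_tau hx
        exact h.eventuallyPeriodic_iff_of_iterate hk
  obtain ⟨φ, hφ, hcomm⟩ := h.exists_equiv_translate hEP
  have hφ' : ∀ {x : ℕ} {i : Letter}, codingMap h x = (fun _ => i) → φ x = h.pred x := fun {x i} hx =>
    IsBranching.Translate.right_unique h (hφ x) ⟨const hx, 0, rfl⟩
  -- Off the code 1, 1, … the map τ is built from σ₁ and σ₂, with which φ commutes. On it φ is the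
  -- shift at both x and τx, and the carry rule applies.
  have hτ : ∀ x, φ (τ x) = τ (φ x) := by
    have key : ∀ k x, h.letter (h.pred^[k] x) = Letter.two → φ (τ x) = τ (φ x) := by
      have two : ∀ x, h.letter x = Letter.two → φ (τ x) = τ (φ x) := fun x hx => by
        rw [← h.apply_letter_pred x, hx, hcomm]
        exact hcomm Letter.one _
      intro k
      induction k with
      | zero => exact two
      | succ k ih =>
        intro x hx
        cases hl : h.letter x with
        | one =>
          rw [← h.apply_letter_pred x, hl, hb.tau_one, hcomm, ih _ hx, hcomm, hb.tau_one]
        | two => exact two x hl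
    intro x
    by_cases hx : codingMap h x = fun _ => Letter.one
    · rw [hφ' hx, hφ' (hb.codingMap_tau hx)]
      exact (hb.letter_tau_of_one (by rw [← h.codingMap_apply_zero, hx])).2
    · obtain ⟨k, hk⟩ := Function.ne_iff.1 hx
      rw [h.codingMap_apply] at hk
      refine key k x ?_
      cases hl : h.letter (h.pred^[k] x) with
      | one => exact (hk hl).elim
      | two => rfl
  obtain ⟨V, hV⟩ := HilbertBasis.exists_equiv e e φ
  have hid := hρ.perm_eq_self (LinearIsometryEquiv.intertwines_of_generators V (π := ρ) (π' := ρ)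
    (LinearIsometryEquiv.intertwines_of_basis e V fun n => by
      change V (ρ Q2.U (e n)) = ρ Q2.U (V (e n))
      rw [hb.map_U, hV, hV, hb.map_U, hτ])
    (LinearIsometryEquiv.intertwines_of_basis e V fun n => by
      change V (ρ Q2.S₂ (e n)) = ρ Q2.S₂ (V (e n))
      rw [hb.map_S₂, hV, hV, hb.map_S₂]
      exact congrArg e (hcomm Letter.two n))) hV
  refine ⟨fun x => ?_, ?_⟩
  · obtain ⟨_, k, hk⟩ := hφ x
    rw [hid] at hk
    exact ⟨k, hk⟩
  · rw [← hφ' (hb.codingMap_tau hn), hid]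

/-- From σ₂τ = τ²σ₂, and the same relation for τ⁻¹: along the τ-orbit of a fixed point, σ₂ doubles
the exponent. -/
theorem sigma_zpow (hb : IsPermutationBasisQ2 ρ e σ₂ τ) {n : ℕ} (hn : σ₂ n = n) (k : ℤ) :
    σ₂ ((τ ^ k) n) = (τ ^ (2 * k)) n := by
  have h1 : ∀ m, σ₂ (τ m) = τ (τ (σ₂ m)) := fun m => (hb.tau_one m).symm
  have h2 : ∀ m, σ₂ (τ⁻¹ m) = τ⁻¹ (τ⁻¹ (σ₂ m)) := fun m => by
    rw [Equiv.Perm.eq_inv_iff_eq, Equiv.Perm.eq_inv_iff_eq, ← h1]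
    exact congrArg σ₂ (τ.apply_symm_apply m)
  induction k using Int.induction_on with
  | zero => simpa using hn
  | succ k ih =>
    rw [add_comm, zpow_one_add, Equiv.Perm.mul_apply, h1, ih, mul_add, mul_one, zpow_add]
    rfl
  | pred k ih =>
    rw [show -(k : ℤ) - 1 = -1 + -k by ring, zpow_add, zpow_neg_one, Equiv.Perm.mul_apply, h2, ih,
      mul_add, zpow_add, show (2 : ℤ) * -1 = -1 + -1 by ring, zpow_add, zpow_neg_one]
    rfl

/-- Descent on the absolute value of the exponent. An even exponent that fixes `n` can be halved,
because σ₂ is injective; an odd one would put `n` in the range of τσ₂ as well as in that of σ₂. -/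
theorem zpow_injective (hb : IsPermutationBasisQ2 ρ e σ₂ τ) {n : ℕ} (hn : σ₂ n = n) {k : ℤ}
    (hk : (τ ^ k) n = n) : k = 0 := by
  induction hd : k.natAbs using Nat.strong_induction_on generalizing k with
  | _ d ih =>
    subst hd
    rcases Int.even_or_odd' k with ⟨c, rfl | rfl⟩
    · by_contra hne
      have h1 : (τ ^ c) n = n := hb.injective (by rw [hb.sigma_zpow hn, hk, hn])
      have := ih c.natAbs (by omega) h1 rfl
      omega
    · rw [add_comm, zpow_one_add, Equiv.Perm.mul_apply, ← hb.sigma_zpow hn] at hk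
      have h1 : branchingOf σ₂ τ Letter.one ((τ ^ c) n) = branchingOf σ₂ τ Letter.two n :=
        hk.trans hn.symm
      cases (hb.isPermutationBasis.branching.eq_of_eq h1).1

/-- An irreducible permutative representation of `𝒬₂` with a basis vector of code `1, 1, …` is
equivalent to the canonical representation, and its coding map is injective. -/
theorem unitarilyEquivalent_canonicalRep (hb : IsPermutationBasisQ2 ρ e σ₂ τ)
    (hρ : IsIrreducibleRep ρ) {n : ℕ}
    (hn : codingMap hb.isPermutationBasis.branching n = fun _ => Letter.one) :
    UnitarilyEquivalent ρ canonicalRep ∧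
      Function.Injective (codingMap hb.isPermutationBasis.branching) := by
  have h := hb.isPermutationBasis.branching
  obtain ⟨hfix, hpred⟩ := hb.exists_iterate_pred_fixed hρ hn
  have hcode := hb.codingMap_tau hn
  -- The point `m` plays the role of 0 in ℤ, and `n` that of -1.
  generalize τ n = m at hpred hcode
  have hm : σ₂ m = m := by
    conv_rhs => rw [← h.apply_letter_pred m, hpred, ← h.codingMap_apply_zero, hcode]
    rfl
  have hinj : Function.Injective fun k : ℤ => (τ ^ k) m := fun k l hkl => by
    have h1 : (τ ^ (k - l)) m = m := by
      rw [sub_eq_neg_add, zpow_add, Equiv.Perm.mul_apply, show (τ ^ k) m = (τ ^ l) m from hkl,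
        zpow_neg]
      exact (τ ^ l).symm_apply_apply m
    exact sub_eq_zero.1 (hb.zpow_injective hm h1)
  have hsurj : Function.Surjective fun k : ℤ => (τ ^ k) m := by
    refine hb.eq_univ_of_isIrreducibleRep hρ (Y := Set.range fun k : ℤ => (τ ^ k) m) (fun x => ?_)
      (fun x => ?_) (n := m) ⟨0, rfl⟩
    · constructor
      · rintro ⟨k, hk⟩
        rcases Int.even_or_odd' k with ⟨c, rfl | rfl⟩
        · exact ⟨c, hb.injective (by rw [← hk]; exact hb.sigma_zpow hm c)⟩
        · have h1 : branchingOf σ₂ τ Letter.one ((τ ^ c) m) = branchingOf σ₂ τ Letter.two x := by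
            refine Eq.trans ?_ hk
            change τ (σ₂ ((τ ^ c) m)) = (τ ^ (2 * c + 1)) m
            rw [hb.sigma_zpow hm, add_comm, zpow_one_add, Equiv.Perm.mul_apply]
          cases (h.eq_of_eq h1).1
      · rintro ⟨k, rfl⟩
        exact ⟨2 * k, (hb.sigma_zpow hm k).symm⟩
    · constructor
      · rintro ⟨k, hk⟩
        refine ⟨k - 1, τ.injective ?_⟩
        rw [← hk]
        change τ ((τ ^ (k - 1)) m) = (τ ^ k) m
        rw [← Equiv.Perm.mul_apply, ← zpow_one_add, add_sub_cancel]
      · rintro ⟨k, rfl⟩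
        exact ⟨1 + k, by simp only [zpow_one_add, Equiv.Perm.mul_apply]⟩
  let g : ℤ ≃ ℕ := Equiv.ofBijective _ ⟨hinj, hsurj⟩
  have hg : ∀ k, g k = (τ ^ k) m := fun _ => rfl
  have hτg : ∀ k, τ (g k) = g (1 + k) := fun k => by
    rw [hg, hg, zpow_one_add, Equiv.Perm.mul_apply]
  have hσg : ∀ k, σ₂ (g k) = g (2 * k) := fun k => hb.sigma_zpow hm k
  constructor
  · obtain ⟨V, hV⟩ := HilbertBasis.exists_equiv e basisZ g.symm
    refine ⟨V, LinearIsometryEquiv.intertwines_of_generators V (π := ρ) (π' := canonicalRep)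
      (LinearIsometryEquiv.intertwines_of_basis e V fun n => ?_)
      (LinearIsometryEquiv.intertwines_of_basis e V fun n => ?_)⟩
    · change V (ρ Q2.U (e n)) = canonicalRep Q2.U (V (e n))
      obtain ⟨k, rfl⟩ := g.surjective n
      rw [hb.map_U, hτg, hV, hV, canonicalRep_U, g.symm_apply_apply, g.symm_apply_apply,
        canonicalU_apply, add_comm]
    · change V (ρ Q2.S₂ (e n)) = canonicalRep Q2.S₂ (V (e n))
      obtain ⟨k, rfl⟩ := g.surjective n
      rw [hb.map_S₂, hσg, hV, hV, canonicalRep_S₂, g.symm_apply_apply, g.symm_apply_apply,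
        canonicalS₂_apply]
  -- On ℤ the equations 2k + 1 = k and 2k = k leave the fixed points -1 and 0 of T, told apart by
  -- their letters. Every point ends in one of them, so its code determines its tail.
  · have hone : ∀ x, h.pred x = x → h.letter x = Letter.one → x = g (-1) := by
      intro x hx hl
      obtain ⟨k, rfl⟩ := g.surjective x
      have h1 : τ (σ₂ (g k)) = g k := by
        conv_rhs => rw [← h.apply_letter_pred (g k), hx, hl]
        rfl
      rw [hσg, hτg] at h1
      have := g.injective h1
      congr 1
      omega
    have htwo : ∀ x, h.pred x = x → h.letter x = Letter.two → x = g 0 := by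
      intro x hx hl
      obtain ⟨k, rfl⟩ := g.surjective x
      have h1 : σ₂ (g k) = g k := by
        conv_rhs => rw [← h.apply_letter_pred (g k), hx, hl]
        rfl
      rw [hσg] at h1
      have := g.injective h1
      congr 1
      omega
    intro x y hxy
    obtain ⟨k, hk⟩ := hfix x
    obtain ⟨l, hl⟩ := hfix y
    refine h.ext_of_codingMap hxy (k := l + k) ?_
    have hx : h.pred (h.pred^[l + k] x) = h.pred^[l + k] x := by
      rw [← Function.iterate_succ_apply' h.pred, h.iterate_pred_congr hk l]
      rfl
    have hy : h.pred (h.pred^[l + k] y) = h.pred^[l + k] y := by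
      rw [← Function.iterate_succ_apply' h.pred, add_comm l k, h.iterate_pred_congr hl k]
      rfl
    have hlet : h.letter (h.pred^[l + k] x) = h.letter (h.pred^[l + k] y) := by
      rw [← h.codingMap_apply, ← h.codingMap_apply, hxy]
    cases hc : h.letter (h.pred^[l + k] x) with
    | one => rw [hone _ hx hc, hone _ hy (hlet.symm.trans hc)]
    | two => rw [htwo _ hx hc, htwo _ hy (hlet.symm.trans hc)]

end IsPermutationBasisQ2

/-- The codes which occur in a permutative representation are invariant under equivalence. -/
theorem IsPermutationBasis.exists_codingMap_eq {π : O2 →⋆ₐ[ℂ] (H →L[ℂ] H)} {π' : O2 →⋆ₐ[ℂ] (K →L[ℂ] K)}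
    {σ σ' : Letter → ℕ → ℕ} {e : HilbertBasis ℕ ℂ H} {f : HilbertBasis ℕ ℂ K}
    (hb : IsPermutationBasis π e σ) (hb' : IsPermutationBasis π' f σ')
    (hV : UnitarilyEquivalent π π') (n : ℕ) :
    ∃ m, codingMap hb'.branching m = codingMap hb.branching n := by
  obtain ⟨V, hV⟩ := hV
  by_contra hne
  rw [not_exists] at hne
  refine e.orthonormal.ne_zero n (V.map_eq_zero_iff.1 (HilbertBasis.ext_inner (e := f) fun j => ?_))
  rw [inner_zero_right]
  -- The vector Ve_n lies in the range of S_w for each prefix w of the code of `n`, so it is carried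
  -- by basis vectors with that code.
  refine hb'.inner_eq_zero_of_code (fun k => ?_) (hne j)
  obtain ⟨z, hz⟩ := hb.exists_word_eq n k
  exact ⟨V z, by rw [← hV, hz]⟩

/-! ### The canonical representation -/

theorem isPermutativeQ2_canonicalRep : IsPermutativeQ2 canonicalRep := by
  obtain ⟨f, hf⟩ := HilbertBasis.exists_reindex basisZ Equiv.intEquivNat.symm
  refine ⟨f, fun n => Equiv.intEquivNat (2 * Equiv.intEquivNat.symm n),
    fun n => Equiv.intEquivNat (Equiv.intEquivNat.symm n + 1), ?_, ?_, fun n => ⟨?_, ?_⟩⟩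
  · exact Equiv.intEquivNat.injective.comp
      ((mul_right_injective₀ two_ne_zero).comp Equiv.intEquivNat.symm.injective)
  · exact Equiv.intEquivNat.bijective.comp
      ((Equiv.addRight (1 : ℤ)).bijective.comp Equiv.intEquivNat.symm.bijective)
  · rw [hf, hf, canonicalRep_S₂, canonicalS₂_apply, Equiv.symm_apply_apply]
  · rw [hf, hf, canonicalRep_U, canonicalU_apply, Equiv.symm_apply_apply]

/-- The projection sends e₀ to a vector fixed by S₂, hence to a multiple of e₀: its coefficients
vanish at odd indices and satisfy x₂ₖ = xₖ. Commuting with U, it is then scalar. -/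
theorem isIrreducibleRep_canonicalRep : IsIrreducibleRep canonicalRep := by
  refine ⟨⟨basisZ 0, 0, basisZ.orthonormal.ne_zero 0⟩, fun M hM hinv => ?_⟩
  have : CompleteSpace M := hM.completeSpace_coe
  have hc := starProjection_comm hinv
  have hU : ∀ x, M.starProjection (canonicalU x) = canonicalU (M.starProjection x) := fun x => by
    rw [← canonicalRep_U, hc]
  have hS : ∀ x, M.starProjection (canonicalS₂ x) = canonicalS₂ (M.starProjection x) := fun x => by
    rw [← canonicalRep_S₂, hc]
  have h0 : ∀ k : ℤ, k ≠ 0 → ⟪basisZ k, M.starProjection (basisZ 0)⟫_ℂ = 0 := by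
    intro k hk
    induction hd : k.natAbs using Nat.strong_induction_on generalizing k with
    | _ d ih =>
      subst hd
      have h1 : M.starProjection (basisZ 0) = canonicalS₂ (M.starProjection (basisZ 0)) := by
        rw [← hS, canonicalS₂_apply, mul_zero]
      rw [h1, ← ContinuousLinearMap.adjoint_inner_left, ← ContinuousLinearMap.star_eq_adjoint]
      rcases Int.even_or_odd' k with ⟨c, rfl | rfl⟩
      · rw [star_canonicalS₂_even]
        exact ih c.natAbs (by omega) c (by omega) rfl
      · rw [star_canonicalS₂_odd, inner_zero_left]
  have h1 := HilbertBasis.eq_smul_of_inner_eq_zero h0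
  set c := ⟪basisZ 0, M.starProjection (basisZ 0)⟫_ℂ
  have hall : ∀ k, M.starProjection (basisZ k) = c • basisZ k := by
    intro k
    induction k using Int.induction_on with
    | zero => exact h1
    | succ k ih => rw [← canonicalU_apply, hU, ih, map_smul]
    | pred k ih =>
      have h2 : star canonicalU (canonicalU (M.starProjection (basisZ (-(k : ℤ) - 1)))) =
          star canonicalU (canonicalU (c • basisZ (-(k : ℤ) - 1))) := by
        rw [← hU, map_smul, canonicalU_apply, sub_add_cancel, ih]
      rwa [isometry_apply canonical_isTwoAdicPair.1, isometry_apply canonical_isTwoAdicPair.1]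
        at h2
  have hscal : M.starProjection = c • (1 : ell2Z →L[ℂ] ell2Z) := basisZ_ext hall
  by_cases hc0 : c = 0
  · left
    rw [Submodule.eq_bot_iff]
    intro x hx
    rw [← Submodule.starProjection_eq_self_iff.2 hx, hscal, hc0]
    simp
  · right
    rw [Submodule.eq_top_iff']
    intro x
    have h2 : c • x ∈ M := by
      have := M.starProjection_apply_mem x
      rwa [hscal] at this
    exact (M.smul_mem_iff hc0).1 h2

/-- The maps k ↦ 2k and k ↦ 2k + 1 preserve the sign in the sense k ≥ 0 or k < 0, so 𝒪₂ does not
connect the two halves of ℤ; only U does. -/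
theorem not_isIrreducibleRep_restrict_canonicalRep :
    ¬ IsIrreducibleRep (restrict canonicalRep) := by
  intro hirr
  have htwo : restrict canonicalRep (UniversalCStar.snd _) = canonicalS₂ :=
    (restrict_two canonicalRep).trans canonicalRep_S₂
  have hone : restrict canonicalRep (UniversalCStar.fst _) = canonicalU * canonicalS₂ := by
    refine (congrArg canonicalRep embed_S₁).trans ?_
    rw [map_mul, canonicalRep_S₂, canonicalRep_U]
  have hs1 : ∀ k, star (canonicalU * canonicalS₂) (basisZ k) =
      star canonicalS₂ (basisZ (k - 1)) := fun k => by
    rw [star_mul, mul_apply_eq_comp, star_canonicalU_apply]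
  have hinv := invariant_of_generators (π := restrict canonicalRep)
    (isClosed_supported basisZ {k | 0 ≤ k})
    (map_mem_supported fun m hm => by
      rw [Set.mem_ofPred_eq, not_le] at hm
      rw [hone, hs1]
      rcases Int.even_or_odd' (m - 1) with ⟨c, hc | hc⟩
      · refine Or.inr ⟨c, fun h : 0 ≤ c => by omega, ?_⟩
        rw [hc, star_canonicalS₂_even]
      · exact Or.inl (by rw [hc, star_canonicalS₂_odd]))
    (map_mem_supported fun m hm => by
      rw [Set.mem_ofPred_eq, not_le] at hm
      rw [htwo]
      rcases Int.even_or_odd' m with ⟨c, hc | hc⟩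
      · refine Or.inr ⟨c, fun h : 0 ≤ c => by omega, ?_⟩
        rw [hc, star_canonicalS₂_even]
      · exact Or.inl (by rw [hc, star_canonicalS₂_odd]))
    (map_mem_supported fun m hm => by
      rw [Set.mem_ofPred_eq, not_le] at hm
      refine Or.inr ⟨2 * m + 1, fun h : 0 ≤ 2 * m + 1 => by omega, ?_⟩
      rw [star_star, hone, mul_apply_eq_comp, canonicalS₂_apply, canonicalU_apply])
    (map_mem_supported fun m hm => by
      rw [Set.mem_ofPred_eq, not_le] at hm
      refine Or.inr ⟨2 * m, fun h : 0 ≤ 2 * m => by omega, ?_⟩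
      rw [star_star, htwo, canonicalS₂_apply])
  rcases hirr.2 _ (isClosed_supported _ _) hinv with h | h
  · have h1 : basisZ 0 ∈ supported basisZ {k : ℤ | 0 ≤ k} := basis_mem_supported.2 (le_refl (0 : ℤ))
    rw [h] at h1
    exact basisZ.orthonormal.ne_zero 0 h1
  · have h1 : basisZ (-1) ∈ supported basisZ {k : ℤ | 0 ≤ k} := by
      rw [h]
      exact Submodule.mem_top
    have h2 : (-1 : ℤ) ∈ {k : ℤ | 0 ≤ k} := basis_mem_supported.1 h1
    exact absurd h2 (by decide)

end

/-! ### Extension to 𝒬₂ and the classification -/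

section

variable {H : Type u} [NormedAddCommGroup H] [InnerProductSpace ℂ H] [CompleteSpace H]
  {K : Type v} [NormedAddCommGroup K] [InnerProductSpace ℂ K] [CompleteSpace K]
  {ρ : Q2 →⋆ₐ[ℂ] (H →L[ℂ] H)} {ρ' : Q2 →⋆ₐ[ℂ] (K →L[ℂ] K)}
  {π : O2 →⋆ₐ[ℂ] (H →L[ℂ] H)} {e : HilbertBasis ℕ ℂ H} {σ : Letter → ℕ → ℕ}

namespace IsBranching

variable (h : IsBranching σ) {i j : Letter}

/-- If no code is `i, i, …`, every `n` is `σ_iᵏ σ_j m` for exactly one pair `(k, m)`. -/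
theorem bijective_iterate (hij : i ≠ j) (hcode : ∀ n, codingMap h n ≠ fun _ => i) :
    Function.Bijective fun p : ℕ × ℕ => (σ i)^[p.1] (σ j p.2) := by
  constructor
  · rintro ⟨k, m⟩ ⟨l, m'⟩ hkl
    dsimp only at hkl
    induction k generalizing l with
    | zero =>
      cases l with
      | zero => rw [h.injective j hkl]
      | succ l =>
        rw [Function.iterate_succ_apply'] at hkl
        exact (hij (h.eq_of_eq hkl).1.symm).elim
    | succ k ih =>
      cases l with
      | zero =>
        rw [Function.iterate_succ_apply'] at hkl
        exact (hij (h.eq_of_eq hkl).1).elim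
      | succ l =>
        rw [Function.iterate_succ_apply', Function.iterate_succ_apply'] at hkl
        have := ih l (h.injective i hkl)
        simp only [Prod.mk.injEq] at this ⊢
        exact ⟨congrArg (· + 1) this.1, this.2⟩
  · have hne : ∀ n, h.letter n ≠ i → h.letter n = j := fun n hn => by
      revert hn hij
      cases h.letter n <;> cases i <;> cases j <;> simp
    have key : ∀ k n, h.letter (h.pred^[k] n) ≠ i →
        ∃ p : ℕ × ℕ, (σ i)^[p.1] (σ j p.2) = n := by
      have zero : ∀ n, h.letter n ≠ i → ∃ p : ℕ × ℕ, (σ i)^[p.1] (σ j p.2) = n := fun n hn =>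
        ⟨(0, h.pred n), by
          conv_rhs => rw [← h.apply_letter_pred n, hne n hn]
          rfl⟩
      intro k
      induction k with
      | zero => exact zero
      | succ k ih =>
        intro n hn
        by_cases hl : h.letter n = i
        · obtain ⟨⟨l, m⟩, hp⟩ := ih _ hn
          refine ⟨(l + 1, m), ?_⟩
          conv_rhs => rw [← h.apply_letter_pred n, hl, ← hp]
          exact Function.iterate_succ_apply' _ _ _
        · exact zero n hl
    intro n
    obtain ⟨k, hk⟩ := Function.ne_iff.1 (hcode n)
    rw [h.codingMap_apply] at hk
    exact key k n hk

/-- The permutation `σ₁ᵏ σ₂ m ↦ σ₂ᵏ σ₁ m`. -/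
theorem exists_odometer (hcode : ∀ i n, codingMap h n ≠ fun _ => i) :
    ∃ τ : Equiv.Perm ℕ, (∀ n, τ (σ Letter.two n) = σ Letter.one n) ∧
      ∀ n, τ (σ Letter.one n) = σ Letter.two (τ n) := by
  -- `F` reads off the number of leading 1s and `G` that of leading 2s. Both are bijections since
  -- neither constant code occurs, and G F⁻¹ is the odometer.
  let F := Equiv.ofBijective _ (h.bijective_iterate (i := Letter.one) (j := Letter.two)
    (by simp) (hcode _))
  let G := Equiv.ofBijective _ (h.bijective_iterate (i := Letter.two) (j := Letter.one)
    (by simp) (hcode _))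
  have hF : ∀ p : ℕ × ℕ, F.symm.trans G ((σ Letter.one)^[p.1] (σ Letter.two p.2)) =
      (σ Letter.two)^[p.1] (σ Letter.one p.2) := fun p => by
    change G (F.symm (F p)) = G p
    rw [F.symm_apply_apply]
  refine ⟨F.symm.trans G, fun n => hF (0, n), fun n => ?_⟩
  obtain ⟨⟨k, m⟩, rfl⟩ := F.surjective n
  have h1 := hF (k + 1, m)
  have h2 := hF (k, m)
  dsimp only at h1 h2
  rw [Function.iterate_succ_apply', Function.iterate_succ_apply'] at h1
  rw [← h2] at h1
  exact h1

end IsBranching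

/-- If no code is `1, 1, …`, a representation of `𝒬₂` is determined by its restriction to `𝒪₂`. -/
theorem eq_of_restrict_eq {ρ ρ' : Q2 →⋆ₐ[ℂ] (H →L[ℂ] H)} (h : restrict ρ' = restrict ρ)
    (hb : IsPermutationBasis (restrict ρ) e σ)
    (hcode : ∀ n, codingMap hb.branching n ≠ fun _ => Letter.one) : ρ' = ρ := by
  refine StarAlgHom.ext fun a => ContinuousLinearMap.ext fun x => ?_
  exact (intertwines_of_restrict (ρ := ρ) (ρ' := ρ') hb hcode (B := ContinuousLinearMap.id ℂ H)
    (fun a x => by rw [h]; rfl) a x).symm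

/-- Every irreducible representation of `𝒪₂` of type `P(I)`, with `I ≠ (1), (2)`, has exactly one
extension to `𝒬₂`. -/
theorem IsTypeP.exists_extension {I : MultiIndex} (hπ : IsIrreducibleRep π) (hI : IsTypeP π I)
    (h1 : I ≠ MultiIndex.single Letter.one) (h2 : I ≠ MultiIndex.single Letter.two) :
    ∃ ρ : Q2 →⋆ₐ[ℂ] (H →L[ℂ] H), restrict ρ = π ∧ IsPermutativeQ2 ρ ∧ IsIrreducibleRep ρ ∧
      ∀ ρ' : Q2 →⋆ₐ[ℂ] (H →L[ℂ] H), restrict ρ' = π → ρ' = ρ := by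
  obtain ⟨e, σ, hb, n, -, hn⟩ := hI
  have hcode : ∀ i m, codingMap hb.branching m ≠ fun _ => i := fun i m hm => by
    have := IsTypeP.eq_single hπ hb hn hm
    cases i
    · exact h1 this
    · exact h2 this
  obtain ⟨τ, hτ2, hτ1⟩ := hb.branching.exists_odometer hcode
  obtain ⟨V, hV⟩ := HilbertBasis.exists_equiv e e τ
  have hS := hb.map_basis
  have hu := mem_unitary_of_linearIsometryEquiv V
  have hone : (V : H →L[ℂ] H) * π (O2.gen Letter.two) = π (O2.gen Letter.one) :=
    HilbertBasis.clm_ext e fun n => by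
      change V (π (O2.gen Letter.two) (e n)) = _
      rw [hS, hV, hτ2, hS]
  have hpair : IsTwoAdicPair (V : H →L[ℂ] H) (π (O2.gen Letter.two)) := by
    -- Since VS₂ = S₁, the relation S₂V = V²S₂ is S₂V = VS₁, the carry rule of τ, and the last
    -- relation is the Cuntz relation.
    refine ⟨hu.1, hu.2, ?_, ?_, ?_⟩
    · rw [← map_star, ← map_mul, O2.star_gen_mul_self, map_one]
    · rw [pow_two, mul_assoc, hone]
      refine HilbertBasis.clm_ext e fun n => ?_
      change π (O2.gen Letter.two) (V (e n)) = V (π (O2.gen Letter.one) (e n))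
      rw [hV, hS, hS, hV, hτ1]
    · rw [mul_assoc, ← star_mul, hone, add_comm, ← map_star, ← map_star, ← map_mul, ← map_mul,
        ← map_add]
      exact (congrArg π O2.isCuntzPair.2.2).trans (map_one π)
  obtain ⟨ρ, ⟨hρU, hρS⟩, -⟩ := Q2.existsUnique_lift _ _ hpair
  have hres : restrict ρ = π := by
    refine (O2.existsUnique_lift _ _ hpair.isCuntzPair).unique ⟨?_, ?_⟩ ⟨hone.symm, rfl⟩
    · exact (congrArg ρ embed_S₁).trans (by rw [map_mul, hρU, hρS])
    · exact (congrArg ρ embed_S₂).trans hρS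
  subst hres
  refine ⟨ρ, rfl, ⟨e, σ Letter.two, τ, hb.branching.injective _, τ.bijective, fun n => ⟨?_, ?_⟩⟩,
    isIrreducibleRep_of_restrict hπ, fun ρ' hρ' => eq_of_restrict_eq hρ' hb (hcode _)⟩
  · rw [hρS, hS]
  · rw [hρU]
    exact hV n

/-- Representations of type `P(1)` and `P(2)` do not extend to `𝒬₂`. -/
theorem not_isTypeP_single (ρ : Q2 →⋆ₐ[ℂ] (H →L[ℂ] H)) (i : Letter) :
    ¬ IsTypeP (restrict ρ) (MultiIndex.single i) := by
  rintro ⟨e, σ, hb, n, hcyc, hn, -⟩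
  have h := hb.branching
  have hn' : restrict ρ (O2.gen i) (e n) = e n := by simpa [O2.word] using hn
  have hfix : σ i n = n := HilbertBasis.injective e (by rw [← hb.map_basis, hn'])
  have hpred : h.pred n = n := by
    conv_lhs => rw [← hfix]
    exact h.pred_apply i n
  have hlet : h.letter n = i := by
    conv_lhs => rw [← hfix]
    exact h.letter_apply i n
  have htail : ∀ m, ∃ k, h.pred^[k] m = n := by
    refine hb.eq_univ_of_isCyclicVector hcyc (Y := {m | ∃ k, h.pred^[k] m = n})
      (fun i m => ⟨?_, ?_⟩) ⟨0, rfl⟩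
    · rintro ⟨k, hk⟩
      have h1 := congrArg h.pred hk
      rw [← Function.iterate_succ_apply' h.pred, Function.iterate_succ_apply, h.pred_apply,
        hpred] at h1
      exact ⟨k, h1⟩
    · rintro ⟨k, hk⟩
      exact ⟨k + 1, by rwa [Function.iterate_succ_apply, h.pred_apply]⟩
  -- A vector fixed by S_j lies in the range of every power of S_j, so it is carried by the code j,
  -- j, …; but every code ends in i, i, ….
  have key : ∀ j ≠ i, ∀ y, restrict ρ (O2.gen j) y = y → y = 0 := by
    intro j hj y hy
    refine HilbertBasis.ext_inner (e := e) fun m => ?_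
    rw [inner_zero_right]
    refine hb.inner_eq_zero_of_code (s := fun _ => j) (fun k => ⟨y, ?_⟩) fun hm => ?_
    · have hw : O2.word (prefixWord (fun _ => j) k) = O2.gen j ^ k := by
        simp [O2.word, prefixWord]
      rw [hw]
      clear hw
      induction k with
      | zero => simp
      | succ k ih => rw [pow_succ, map_mul, mul_apply_eq_comp, hy, ih]
    · obtain ⟨k, hk⟩ := htail m
      have h1 := h.codingMap_apply m k
      rw [hm, hk, hlet] at h1
      exact hj h1
  have hne := e.orthonormal.ne_zero n
  cases i with
  | one =>
    refine hne ?_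
    -- If S₁Ω = Ω, then S₂UΩ = US₁Ω = UΩ, so UΩ = 0.
    rw [← star_U_U_apply ρ (e n), key Letter.two (by simp) (ρ Q2.U (e n)) (by
      rw [← U_restrict_one_apply, hn']), map_zero]
  | two =>
    refine hne ?_
    -- If S₂Ω = Ω, then US₁U*Ω = S₂UU*Ω = Ω, so S₁ fixes U*Ω, which must vanish.
    have h0 := key Letter.one (by simp) (star (ρ Q2.U) (e n)) (by
      rw [← star_U_U_apply ρ (restrict ρ _ _), U_restrict_one_apply, U_star_U_apply, hn'])
    rw [← U_star_U_apply ρ (e n), h0, map_zero]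

theorem UnitarilyEquivalent.restrict (h : UnitarilyEquivalent ρ ρ') :
    UnitarilyEquivalent (restrict ρ) (restrict ρ') := by
  obtain ⟨V, hV⟩ := h
  exact ⟨V, fun a => hV (embed a)⟩

/-- Codes are invariants of the restriction. If 1, 1, … occurs in one representation it occurs in
both, and both are canonical; otherwise the unitary between the restrictions already intertwines U.
-/
theorem unitarilyEquivalent_of_restrict (hρ : IsPermutativeQ2 ρ) (hirr : IsIrreducibleRep ρ)
    (hρ' : IsPermutativeQ2 ρ') (hirr' : IsIrreducibleRep ρ')
    (h : UnitarilyEquivalent (restrict ρ) (restrict ρ')) : UnitarilyEquivalent ρ ρ' := by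
  obtain ⟨e, σ₂, τ, hb⟩ := hρ.exists_basis
  obtain ⟨f, σ₂', τ', hb'⟩ := hρ'.exists_basis
  by_cases hcode : ∃ n, codingMap hb.isPermutationBasis.branching n = fun _ => Letter.one
  · obtain ⟨n, hn⟩ := hcode
    obtain ⟨m, hm⟩ := hb.isPermutationBasis.exists_codingMap_eq
      hb'.isPermutationBasis h n
    obtain ⟨V, hV⟩ := (hb.unitarilyEquivalent_canonicalRep hirr hn).1
    obtain ⟨V', hV'⟩ := (hb'.unitarilyEquivalent_canonicalRep hirr' (hm.trans hn)).1
    refine ⟨V.trans V'.symm, fun a x => V'.injective ?_⟩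
    rw [LinearIsometryEquiv.trans_apply, LinearIsometryEquiv.trans_apply, V'.apply_symm_apply, hV',
      V'.apply_symm_apply, hV]
  · obtain ⟨V, hV⟩ := h
    exact ⟨V, intertwines_of_restrict (B := (V : H →L[ℂ] K)) hb.isPermutationBasis
      (not_exists.1 hcode) hV⟩

/-- The restriction to `𝒪₂` of an irreducible permutative representation of `𝒬₂`. -/
theorem restrict_classification (hρ : IsPermutativeQ2 ρ) (hirr : IsIrreducibleRep ρ) :
    (UnitarilyEquivalent (restrict ρ) (restrict canonicalRep) ∨
      ∃ I : MultiIndex, IsIrreducibleRep (restrict ρ) ∧ IsTypeP (restrict ρ) I) ∧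
    IsMultiplicityFree (restrict ρ) := by
  obtain ⟨e, σ₂, τ, hb⟩ := hρ.exists_basis
  have hO := hb.isPermutationBasis
  have hmf : Function.Injective (codingMap hO.branching) → IsMultiplicityFree (restrict ρ) :=
    fun hinj => ⟨⟨e, _, hO⟩, fun f σ hb' => hO.injective_codingMap hinj hb'⟩
  by_cases hcode : ∃ n, codingMap hO.branching n = fun _ => Letter.one
  · obtain ⟨n, hn⟩ := hcode
    obtain ⟨hequiv, hinj⟩ := hb.unitarilyEquivalent_canonicalRep hirr hn
    exact ⟨Or.inl hequiv.restrict, hmf hinj⟩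
  · have hirrO := isIrreducibleRep_restrict hirr hO (not_exists.1 hcode)
    obtain ⟨I, hI⟩ := hO.exists_isTypeP hirrO
    exact ⟨Or.inr ⟨I, hirrO, hI⟩, hmf (hO.injective_codingMap_of_irreducible hirrO)⟩

end

end TwoAdic

theorem mainTheorem4 :
    -- the restriction of an irreducible permutative representation
    (∀ (H : Type u) [NormedAddCommGroup H] [InnerProductSpace ℂ H] [CompleteSpace H]
      (ρ : Q2 →⋆ₐ[ℂ] (H →L[ℂ] H)), IsPermutativeQ2 ρ → IsIrreducibleRep ρ →
        (UnitarilyEquivalent (restrict ρ) (restrict canonicalRep) ∨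
          ∃ I : MultiIndex, IsIrreducibleRep (restrict ρ) ∧ IsTypeP (restrict ρ) I) ∧
        IsMultiplicityFree (restrict ρ)) ∧
    -- the classification: the canonical representation
    (IsPermutativeQ2 canonicalRep ∧ IsIrreducibleRep canonicalRep ∧
      ¬ IsIrreducibleRep (restrict canonicalRep)) ∧
    -- the classification: extension of the irreducible representations of type `P(I)`
    (∀ (H : Type u) [NormedAddCommGroup H] [InnerProductSpace ℂ H] [CompleteSpace H]
      (π : O2 →⋆ₐ[ℂ] (H →L[ℂ] H)) (I : MultiIndex), IsIrreducibleRep π → IsTypeP π I →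
        I ≠ MultiIndex.single Letter.one → I ≠ MultiIndex.single Letter.two →
        ∃ ρ : Q2 →⋆ₐ[ℂ] (H →L[ℂ] H), restrict ρ = π ∧ IsPermutativeQ2 ρ ∧ IsIrreducibleRep ρ ∧
          ∀ ρ' : Q2 →⋆ₐ[ℂ] (H →L[ℂ] H), restrict ρ' = π → ρ' = ρ) ∧
    -- the classification: the representations of type `P(1)` and `P(2)` do not extend
    (∀ (H : Type u) [NormedAddCommGroup H] [InnerProductSpace ℂ H] [CompleteSpace H]
      (ρ : Q2 →⋆ₐ[ℂ] (H →L[ℂ] H)) (i : Letter),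
        ¬ IsTypeP (restrict ρ) (MultiIndex.single i)) ∧
    -- the classification: the restriction is a complete invariant
    (∀ (H : Type u) [NormedAddCommGroup H] [InnerProductSpace ℂ H] [CompleteSpace H]
      (K : Type v) [NormedAddCommGroup K] [InnerProductSpace ℂ K] [CompleteSpace K]
      (ρ : Q2 →⋆ₐ[ℂ] (H →L[ℂ] H)) (ρ' : Q2 →⋆ₐ[ℂ] (K →L[ℂ] K)),
        IsPermutativeQ2 ρ → IsIrreducibleRep ρ → IsPermutativeQ2 ρ' → IsIrreducibleRep ρ' →
        (UnitarilyEquivalent ρ ρ' ↔ UnitarilyEquivalent (restrict ρ) (restrict ρ'))) := ⟨fun _ _ _ _ _ hρ hirr => restrict_classification hρ hirr,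
    ⟨isPermutativeQ2_canonicalRep, isIrreducibleRep_canonicalRep,
      not_isIrreducibleRep_restrict_canonicalRep⟩,
    fun _ _ _ _ _ _ hπ hI h1 h2 => hI.exists_extension hπ h1 h2,
    fun _ _ _ _ ρ i => not_isTypeP_single ρ i,
    fun _ _ _ _ _ _ _ _ _ _ hρ hirr hρ' hirr' =>
      ⟨UnitarilyEquivalent.restrict, unitarilyEquivalent_of_restrict hρ hirr hρ' hirr'⟩⟩
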